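/- Let $a,b,c>0$ with $b<c$, and put $p=\sqrt{\frac{a^2+b^2}{a^2+c^2}}$, $q=\sqrt{-\frac{b^2-c^2}{a^2+c^2}}$, so that $p,q\in(0,1)$ and $p^2+q^2=1$. Let $\mathrm{sn}_q,\mathrm{cn}_q,\mathrm{dn}_q$ be the Jacobi elliptic functions with modulus $q$. Let $\mathbb L=\{u+jv \mid u,v\in\mathbb R\}$, $j^2=1$, be the algebra of Lorentz numbers, with $\mathrm{Re}(u+jv)=u$. A real analytic function $f$ on an interval $I$ is extended to $\{u+jv\mid u\pm v\in I\}$ by $f(u+jv)=f(u+v)\frac{1+j}{2}+f(u-v)\frac{1-j}{2}$. For $\mathrm{sn}_q$, $\mathrm{cn}_q$, $\arctan$ (on $\mathbb R$) and $\operatorname{artanh}$ (on $(-1,1)$) this extension is $\mathbb L$-analytic, that is, it has a power series expansion with coefficients in $\mathbb L$ around every point. A curvature line parametrization is a smooth immersion $(u,v)\mapsto x(u,v)\in\mathbb R^3$ of an open set such that $(x_u,x_v)=0$ and $\det(x_{uv},x_u,x_v)=0$. A Christoffel dual of a surface $x$ is a surface $x^\ast$ with the same parameters that is conformally related to $x$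 by parallel tangent planes, where the relation reverses the orientation. Then the map $$\alpha x(u,v)=\frac{1}{\mathrm{sn}_q u\;\mathrm{dn}_q v}\begin{pmatrix} a\,\mathrm{cn}_q u\\ -b\,\mathrm{sn}_q v\,\mathrm{dn}_q u\\ c\,\mathrm{cn}_q v\end{pmatrix},\qquad \mathrm{sn}_q u\neq 0,$$ is a curvature line parametrization whose image is the $1$-sheeted hyperboloid $1+(\frac{x_1}{a})^2=(\frac{x_2}{b})^2+(\frac{x_3}{c})^2$ in Euclidean space $\mathbb R^3$. With $z=u+jv\in\mathbb L$, the map $$\alpha x^\ast(z)=\mathrm{Re}\begin{pmatrix} -\frac{2a}{p}\arctan\frac{\mathrm{cn}_q z}{p\,\mathrm{sn}_q z}\\ j\,\frac{2b}{pq}\arctan\frac{q\,\mathrm{cn}_q z}{p}\\ \frac{2c}{q}\operatorname{artanh}(q\,\mathrm{sn}_q z)\end{pmatrix}$$ is a curvature line parametrization of a Christoffel dual of $\alpha x$, in the same parameters $(u,v)$. This holds 1. with the principal value of $\arctan$, wherever $\mathrm{sn}_q u\ne0$ and $\mathrm{sn}_q z$ is invertible in $\mathbb L$ (that is, $\mathrm{sn}_q(u+v)\,\mathrm{sn}_q(u-v)\neq0$);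 and 2. on all of $\{\mathrm{sn}_q u\neq0\}$, if in the first component $\arctan\frac{\mathrm{cn}_q}{p\,\mathrm{sn}_q}$ is replaced by the $\mathbb L$-analytic extension of a suitable real analytic function $\theta:\mathbb R\to\mathbb R$ with $p\,\mathrm{sn}_q\sin\theta=\mathrm{cn}_q\cos\theta$ (a continuous branch of $\arctan\frac{\mathrm{cn}_q}{p\,\mathrm{sn}_q}$). -/

import Mathlib

open Set Filter Topology
open scoped ContDiff

noncomputable section

/-! Lorentz numbers and Lorentz-analytic functions -/

/-- The algebra `𝕃 = {u + j v}` of Lorentz numbers (`j ^ 2 = 1`): `⟨u, v⟩` stands for `u + j v`.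
The inverse of an invertible `z` is `(z * conj z)⁻¹ • conj z`. -/
abbrev LorentzNumber : Type := QuadraticAlgebra ℝ 1 0

namespace LorentzNumber

/-- The Lorentz unit `j`. -/
def j : LorentzNumber := QuadraticAlgebra.omega

/-- The usual topology of `𝕃 = ℝ²`. -/
instance : TopologicalSpace LorentzNumber :=
  TopologicalSpace.induced (fun z => (z.re, z.im)) inferInstance

/-- `F` is given by a power series with coefficients in `𝕃` around `z₀`. -/
def AnalyticAt (F : LorentzNumber → LorentzNumber) (z₀ : LorentzNumber) : Prop :=
  ∃ A : ℕ → LorentzNumber, ∀ᶠ z in 𝓝 z₀, HasSum (fun n => A n * (z - z₀) ^ n) (F z)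

/-- The domain `{u + j v | u ± v ∈ I}`. -/
def diamond (I : Set ℝ) : Set LorentzNumber := {z | z.re + z.im ∈ I ∧ z.re - z.im ∈ I}

/-- `F` is an `𝕃`-analytic extension of `f : I → ℝ` to `{u + j v | u ± v ∈ I}`. -/
def IsAnalyticExtension (f : ℝ → ℝ) (I : Set ℝ) (F : LorentzNumber → LorentzNumber) : Prop :=
  (∀ z ∈ diamond I, AnalyticAt F z) ∧ ∀ t ∈ I, F ⟨t, 0⟩ = ⟨f t, 0⟩

/-- The Lorentz extension of a real function,
`u + j v ↦ f (u + v) (1 + j) / 2 + f (u - v) (1 - j) / 2`. -/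
def extend (f : ℝ → ℝ) (z : LorentzNumber) : LorentzNumber :=
  f (z.re + z.im) • ((1 / 2 : ℝ) • (1 + j)) + f (z.re - z.im) • ((1 / 2 : ℝ) • (1 - j))

end LorentzNumber

/-! Jacobi elliptic functions with real modulus `0 ≤ k < 1` -/

namespace Jacobi

/-- The incomplete elliptic integral of the first kind. -/
def ellipticF (k φ : ℝ) : ℝ := ∫ t in (0 : ℝ)..φ, 1 / √(1 - k ^ 2 * Real.sin t ^ 2)

/-- The Jacobi amplitude, the inverse of `φ ↦ ellipticF k φ` (a bijection of `ℝ` for `|k| < 1`). -/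
def am (k : ℝ) : ℝ → ℝ := Function.invFun (ellipticF k)

def sn (k u : ℝ) : ℝ := Real.sin (am k u)

def cn (k u : ℝ) : ℝ := Real.cos (am k u)

def dn (k u : ℝ) : ℝ := √(1 - k ^ 2 * sn k u ^ 2)

end Jacobi

/-! Surfaces in Euclidean 3-space -/

/-- Euclidean 3-space. -/
abbrev E3 : Type := EuclideanSpace ℝ (Fin 3)

/-- The partial derivative `x_u`. -/
def partialU (x : ℝ × ℝ → E3) (w : ℝ × ℝ) : E3 := fderiv ℝ x w (1, 0)

/-- The partial derivative `x_v`. -/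
def partialV (x : ℝ × ℝ → E3) (w : ℝ × ℝ) : E3 := fderiv ℝ x w (0, 1)

/-- `x` is a smooth immersion of the open set `U`. -/
def IsSurfacePatch (U : Set (ℝ × ℝ)) (x : ℝ × ℝ → E3) : Prop :=
  IsOpen U ∧ ContDiffOn ℝ ∞ x U ∧ ∀ w ∈ U, LinearIndependent ℝ ![partialU x w, partialV x w]

/-- `x` is a curvature line parametrization: `(u, v)` are orthogonal, `(x_u, x_v) = 0`, and
conjugate, `det (x_uv, x_u, x_v) = 0`. -/
def IsCurvatureLineParam (U : Set (ℝ × ℝ)) (x : ℝ × ℝ → E3) : Prop :=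
  IsSurfacePatch U x ∧ ∀ w ∈ U,
    inner ℝ (partialU x w) (partialV x w) = 0 ∧
    Matrix.det (Matrix.of
      ![(partialV (partialU x) w).ofLp, (partialU x w).ofLp, (partialV x w).ofLp]) = 0

/-- `y` is a Christoffel dual of `x`: the two surfaces have parallel tangent planes and are
conformally related, and the relation reverses the orientation. -/
def IsChristoffelDual (U : Set (ℝ × ℝ)) (x y : ℝ × ℝ → E3) : Prop :=
  IsSurfacePatch U x ∧ IsSurfacePatch U y ∧ ∀ w ∈ U,
    (∃ s₁ s₂ t₁ t₂ : ℝ,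
      partialU y w = s₁ • partialU x w + s₂ • partialV x w ∧
      partialV y w = t₁ • partialU x w + t₂ • partialV x w ∧ s₁ * t₂ - s₂ * t₁ < 0) ∧
    ∃ μ : ℝ, 0 < μ ∧
      inner ℝ (partialU y w) (partialU y w) = μ * inner ℝ (partialU x w) (partialU x w) ∧
      inner ℝ (partialU y w) (partialV y w) = μ * inner ℝ (partialU x w) (partialV x w) ∧
      inner ℝ (partialV y w) (partialV y w) = μ * inner ℝ (partialV x w) (partialV x w)

/-! The hyperboloid and its dual -/

namespace Hyperboloid

open Jacobi LorentzNumber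

/-- The 1-sheeted hyperboloid `1 + (x₁/a)² = (x₂/b)² + (x₃/c)²`. -/
def surface (a b c : ℝ) : Set E3 :=
  {x | 1 + (x 0 / a) ^ 2 = (x 1 / b) ^ 2 + (x 2 / c) ^ 2}

/-- The parametrization of the hyperboloid. -/
def param (a b c q : ℝ) (w : ℝ × ℝ) : E3 :=
  (1 / (sn q w.1 * dn q w.2)) • !₂[a * cn q w.1, -b * sn q w.2 * dn q w.1, c * cn q w.2]

/-- The domain of `param`: `sn_q u ≠ 0`. -/
def domain (q : ℝ) : Set (ℝ × ℝ) := {w | sn q w.1 ≠ 0}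

/-- The dual surface at `z = u + j v`, with a function `T : 𝕃 → 𝕃` in the place of
`arctan (cn_q / (p sn_q))`. -/
def dualWith (a b c p q : ℝ) (T : LorentzNumber → LorentzNumber) (w : ℝ × ℝ) : E3 :=
  let z : LorentzNumber := ⟨w.1, w.2⟩
  !₂[(-(2 * a / p) • T z).re,
     (j * ((2 * b / (p * q)) • extend Real.arctan ((q / p) • extend (cn q) z))).re,
     ((2 * c / q) • extend Real.artanh (q • extend (sn q) z)).re]

/-- The dual surface, with the principal branch of `arctan`. -/
def dual (a b c p q : ℝ) : ℝ × ℝ → E3 :=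
  dualWith a b c p q fun z => extend Real.arctan (extend (cn q) z / (p • extend (sn q) z))

/-- The part of `domain` where the quotient in `dual` is defined, that is, where
`sn_q z` is an invertible Lorentz number. -/
def dualDomain (q : ℝ) : Set (ℝ × ℝ) :=
  {w | w ∈ domain q ∧ IsUnit (extend (sn q) ⟨w.1, w.2⟩)}

end Hyperboloid

end

/-! Write $x$ for the hyperboloid patch and $y$ for the dual. Everything about $y$ follows from the
two relations $y_u=-r\,x_u$, $y_v=r\,x_v$ with $r>0$: tangent planes are parallel, lengths scale by
$r$, the opposite signs reverse the orientation, and $y_{uv}=-r\,x_{uv}-r_v\,x_u$ stays in the span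
of $x_{uv},x_u$, so conjugacy passes from $x$ to $y$
(`isCurvatureLineParam_and_isChristoffelDual_of_smul`).

For $x$ itself, the derivative rules of sn, cn, dn give explicit partial derivatives. Orthogonality
is then the relation $q^2(a^2+c^2)=c^2-b^2$, and conjugacy follows from the quadratic relations
between sn, cn and dn.

For $y$, the null coordinates $u\pm v$ identify $\mathbb L$ with $\mathbb R\times\mathbb R$. Each
component of $y$ becomes $f(u+v)\pm f(u-v)$ up to a factor, where $f'$ is a multiple of
$1/\mathrm{dn}$, $\mathrm{sn}/\mathrm{dn}$ or $\mathrm{cn}/\mathrm{dn}$. The addition theorems turn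
these sums into products, which are exactly $\mp r\,x_u$, $r\,x_v$ with $r$ = `dualRatio`
(`dualRatio_smul_partialU`, `dualRatio_smul_partialV`).

Only $f'$ matters here, so the principal arctangent and a global branch are treated alike. The
global branch is $-\mathrm{am}(t+K)$, with $K$ the complete elliptic integral. That the image is the
whole hyperboloid is an intermediate value argument in $v$ (`image_param`). -/

namespace Jacobi

/-! ### Amplitude and Jacobi functions: bijectivity, analyticity, derivatives. -/

variable {k : ℝ}

theorem one_sub_sq_mul_sin_sq_pos (hk : k ^ 2 < 1) (t : ℝ) :
    0 < 1 - k ^ 2 * Real.sin t ^ 2 := by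
  nlinarith [Real.sin_sq_le_one t, sq_nonneg (Real.sin t), sq_nonneg k]

theorem continuous_ellipticF_integrand (hk : k ^ 2 < 1) :
    Continuous fun t : ℝ => 1 / √(1 - k ^ 2 * Real.sin t ^ 2) := by
  refine continuous_const.div (by fun_prop) fun t => ?_
  exact (Real.sqrt_pos.2 (one_sub_sq_mul_sin_sq_pos hk t)).ne'

theorem hasDerivAt_ellipticF (hk : k ^ 2 < 1) (φ : ℝ) :
    HasDerivAt (ellipticF k) (1 / √(1 - k ^ 2 * Real.sin φ ^ 2)) φ :=
  (continuous_ellipticF_integrand hk).integral_hasStrictDerivAt 0 φ |>.hasDerivAt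

theorem one_le_ellipticF_integrand (hk : k ^ 2 < 1) (t : ℝ) :
    1 ≤ 1 / √(1 - k ^ 2 * Real.sin t ^ 2) := by
  rw [le_div_iff₀ (Real.sqrt_pos.2 (one_sub_sq_mul_sin_sq_pos hk t)), one_mul, Real.sqrt_le_one]
  nlinarith [mul_nonneg (sq_nonneg k) (sq_nonneg (Real.sin t))]

theorem ellipticF_zero : ellipticF k 0 = 0 := by simp [ellipticF]

theorem ellipticF_neg (φ : ℝ) : ellipticF k (-φ) = -ellipticF k φ := by
  have h := intervalIntegral.integral_comp_neg (a := 0) (b := φ)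
    (fun t : ℝ => 1 / √(1 - k ^ 2 * Real.sin t ^ 2))
  simp only [Real.sin_neg, neg_sq, neg_zero] at h
  rw [ellipticF, ellipticF, h, intervalIntegral.integral_symm]

theorem strictMono_ellipticF (hk : k ^ 2 < 1) : StrictMono (ellipticF k) :=
  strictMono_of_hasDerivAt_pos (hasDerivAt_ellipticF hk) fun t =>
    zero_lt_one.trans_le (one_le_ellipticF_integrand hk t)

/-- The integrand is at least 1. Comparison with the identity makes `ellipticF` unbounded in both
directions, hence surjective. -/
theorem monotone_ellipticF_sub_id (hk : k ^ 2 < 1) : Monotone fun φ => ellipticF k φ - φ :=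
  monotone_of_hasDerivAt_nonneg (fun φ => (hasDerivAt_ellipticF hk φ).sub (hasDerivAt_id φ))
    fun t => sub_nonneg.2 (one_le_ellipticF_integrand hk t)

theorem continuous_ellipticF (hk : k ^ 2 < 1) : Continuous (ellipticF k) :=
  continuous_iff_continuousAt.2 fun φ => (hasDerivAt_ellipticF hk φ).continuousAt

theorem bijective_ellipticF (hk : k ^ 2 < 1) : Function.Bijective (ellipticF k) := by
  refine ⟨(strictMono_ellipticF hk).injective, (continuous_ellipticF hk).surjective ?_ ?_⟩
  · refine tendsto_atTop_mono' _ ?_ tendsto_id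
    filter_upwards [eventually_ge_atTop 0] with φ hφ
    have := monotone_ellipticF_sub_id hk hφ
    simp only [ellipticF_zero, id] at *
    linarith
  · refine tendsto_atBot_mono' _ ?_ tendsto_id
    filter_upwards [eventually_le_atBot 0] with φ hφ
    have := monotone_ellipticF_sub_id hk hφ
    simp only [ellipticF_zero, id] at *
    linarith

-- The integrand extends holomorphically to a complex disc around `φ`, where the radicand avoids the
-- branch cut. It has a primitive there, whose real part on the real axis differs from `ellipticF`
-- by a constant.
open Complex in
theorem analyticAt_ellipticF (hk : k ^ 2 < 1) (φ : ℝ) : AnalyticAt ℝ (ellipticF k) φ := by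
  set h : ℂ → ℂ := fun z => 1 - (k : ℂ) ^ 2 * Complex.sin z ^ 2 with hh
  have hreal (t : ℝ) : h t = ((1 - k ^ 2 * Real.sin t ^ 2 : ℝ) : ℂ) := by simp [hh]
  have hcont : Continuous h := by fun_prop
  have hmem : h φ ∈ slitPlane := by
    rw [hreal, Complex.ofReal_mem_slitPlane]
    exact one_sub_sq_mul_sin_sq_pos hk φ
  obtain ⟨r, hr, hball⟩ := Metric.isOpen_iff.1 (isOpen_slitPlane.preimage hcont) (φ : ℂ) hmem
  have hdiff : DifferentiableOn ℂ (fun z => h z ^ (-(1 / 2) : ℂ)) (Metric.ball (φ : ℂ) r) := by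
    intro z hz
    have h1 : DifferentiableAt ℂ h z := by fun_prop
    exact (h1.cpow_const (hball hz)).differentiableWithinAt
  obtain ⟨G, hG⟩ := hdiff.isExactOn_ball
  have hGan : AnalyticAt ℂ G φ :=
    (show DifferentiableOn ℂ G (Metric.ball (φ : ℂ) r) from fun z hz =>
      (hG z hz).differentiableAt.differentiableWithinAt).analyticAt
      (Metric.isOpen_ball.mem_nhds (Metric.mem_ball_self hr))
  have hgan : AnalyticAt ℝ (fun t : ℝ => (G t).re) φ :=
    (Complex.reCLM.analyticAt _).comp
      (AnalyticAt.comp (hGan.restrictScalars (𝕜 := ℝ)) (Complex.ofRealCLM.analyticAt φ))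
  have hderiv : ∀ t ∈ Metric.ball φ r,
      HasDerivAt (fun t : ℝ => (G t).re) (1 / √(1 - k ^ 2 * Real.sin t ^ 2)) t := by
    intro t ht
    have hz : (t : ℂ) ∈ Metric.ball (φ : ℂ) r := by
      rw [Metric.mem_ball, Complex.dist_eq, ← Complex.ofReal_sub, Complex.norm_real]
      simpa [Real.dist_eq] using ht
    have h1 := (hG t hz).real_of_complex
    convert h1 using 1
    have hpos := one_sub_sq_mul_sin_sq_pos hk t
    simp only []
    rw [hreal, show (-(1 / 2) : ℂ) = ((-(1 / 2) : ℝ) : ℂ) by push_cast; rfl,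
      ← Complex.ofReal_cpow hpos.le, Complex.ofReal_re, Real.rpow_neg hpos.le,
      ← Real.sqrt_eq_rpow, one_div]
  have heq : ∀ t ∈ Metric.ball φ r, (G t).re - (G φ).re + ellipticF k φ = ellipticF k t := by
    have hconst (t : ℝ) (ht : t ∈ Metric.ball φ r) := (convex_ball φ r).is_const_of_fderivWithin_eq_zero (𝕜 := ℝ)
      (f := fun t : ℝ => (G t).re - ellipticF k t)
      (fun t ht => ((hderiv t ht).sub
        (hasDerivAt_ellipticF hk t)).differentiableAt.differentiableWithinAt)
      (fun t ht => by
        have := ((hderiv t ht).sub (hasDerivAt_ellipticF hk t)).hasFDerivAt.hasFDerivWithinAt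
          (s := Metric.ball φ r)
        rw [show (fun t : ℝ => (G t).re - ellipticF k t) =
          ((fun t : ℝ => (G t).re) - ellipticF k) from rfl,
          this.fderivWithin (Metric.isOpen_ball.uniqueDiffWithinAt ht)]
        ext; simp) ht (Metric.mem_ball_self hr)
    intro t ht
    have := hconst t ht
    linarith
  refine AnalyticAt.congr ((hgan.sub (analyticAt_const (v := (G φ).re))).add
    (analyticAt_const (v := ellipticF k φ))) ?_
  filter_upwards [Metric.ball_mem_nhds φ hr] with t ht using heq t ht

theorem am_ellipticF (hk : k ^ 2 < 1) (φ : ℝ) : am k (ellipticF k φ) = φ :=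
  Function.leftInverse_invFun (bijective_ellipticF hk).1 φ

theorem ellipticF_am (hk : k ^ 2 < 1) (u : ℝ) : ellipticF k (am k u) = u :=
  Function.rightInverse_invFun (bijective_ellipticF hk).2 u

theorem am_zero (hk : k ^ 2 < 1) : am k 0 = 0 := by
  simpa [ellipticF_zero] using am_ellipticF hk 0

theorem am_neg (hk : k ^ 2 < 1) (u : ℝ) : am k (-u) = -am k u := by
  rw [← am_ellipticF hk (-am k u), ellipticF_neg, ellipticF_am hk]

/-- Analytic inverse function theorem: `am k ∘ ellipticF k` is the identity and `ellipticF` has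
nonvanishing derivative. -/
theorem analyticAt_am (hk : k ^ 2 < 1) (u : ℝ) : AnalyticAt ℝ (am k) u := by
  have hd := hasDerivAt_ellipticF hk (am k u)
  have h := analyticAt_comp_iff_of_deriv_ne_zero (g := am k) (analyticAt_ellipticF hk (am k u))
    (by rw [hd.deriv]; exact (zero_lt_one.trans_le (one_le_ellipticF_integrand hk _)).ne')
  rw [ellipticF_am hk] at h
  refine h.1 ?_
  rw [show am k ∘ ellipticF k = id from funext (am_ellipticF hk)]
  exact analyticAt_id

theorem dn_pos (hk : k ^ 2 < 1) (u : ℝ) : 0 < dn k u :=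
  Real.sqrt_pos.2 (one_sub_sq_mul_sin_sq_pos hk _)

theorem hasDerivAt_am (hk : k ^ 2 < 1) (u : ℝ) : HasDerivAt (am k) (dn k u) u := by
  have hF := hasDerivAt_ellipticF hk (am k u)
  have h := hF.of_local_left_inverse (analyticAt_am hk u).continuousAt
    (zero_lt_one.trans_le (one_le_ellipticF_integrand hk _)).ne'
    (Eventually.of_forall (ellipticF_am hk))
  simpa [dn, sn] using h

theorem cn_sq (k u : ℝ) : cn k u ^ 2 = 1 - sn k u ^ 2 := by
  rw [cn, sn, Real.cos_sq']

theorem dn_sq (hk : k ^ 2 < 1) (u : ℝ) : dn k u ^ 2 = 1 - k ^ 2 * sn k u ^ 2 :=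
  Real.sq_sqrt (one_sub_sq_mul_sin_sq_pos hk _).le

theorem hasDerivAt_sn (hk : k ^ 2 < 1) (u : ℝ) :
    HasDerivAt (sn k) (cn k u * dn k u) u :=
  (hasDerivAt_am hk u).sin

theorem hasDerivAt_cn (hk : k ^ 2 < 1) (u : ℝ) :
    HasDerivAt (cn k) (-sn k u * dn k u) u :=
  (hasDerivAt_am hk u).cos

theorem hasDerivAt_dn (hk : k ^ 2 < 1) (u : ℝ) :
    HasDerivAt (dn k) (-k ^ 2 * sn k u * cn k u) u := by
  have h := ((((hasDerivAt_sn hk u).pow 2).const_mul (k ^ 2)).const_sub 1).sqrt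
    (one_sub_sq_mul_sin_sq_pos hk (am k u)).ne'
  refine h.congr_deriv ?_
  change _ / (2 * dn k u) = _
  have := (dn_pos hk u).ne'
  push_cast
  field_simp

theorem analyticAt_sn (hk : k ^ 2 < 1) (u : ℝ) : AnalyticAt ℝ (sn k) u :=
  Real.analyticAt_sin.comp (analyticAt_am hk u)

theorem analyticAt_cn (hk : k ^ 2 < 1) (u : ℝ) : AnalyticAt ℝ (cn k) u :=
  Real.analyticAt_cos.comp (analyticAt_am hk u)

theorem analyticAt_dn (hk : k ^ 2 < 1) (u : ℝ) : AnalyticAt ℝ (dn k) u :=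
  AnalyticAt.comp (g := Real.sqrt) (f := fun u => 1 - k ^ 2 * sn k u ^ 2)
    (Real.contDiffAt_sqrt (one_sub_sq_mul_sin_sq_pos hk _).ne' (n := ω)).analyticAt
    (analyticAt_const.sub (analyticAt_const.mul ((analyticAt_sn hk u).pow 2)))

theorem sn_zero (hk : k ^ 2 < 1) : sn k 0 = 0 := by simp [sn, am_zero hk]

theorem cn_zero (hk : k ^ 2 < 1) : cn k 0 = 1 := by simp [cn, am_zero hk]

theorem dn_zero (hk : k ^ 2 < 1) : dn k 0 = 1 := by simp [dn, sn_zero hk]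

theorem sn_neg (hk : k ^ 2 < 1) (u : ℝ) : sn k (-u) = -sn k u := by
  simp [sn, am_neg hk]

theorem cn_neg (hk : k ^ 2 < 1) (u : ℝ) : cn k (-u) = cn k u := by
  simp [cn, am_neg hk]

theorem dn_neg (hk : k ^ 2 < 1) (u : ℝ) : dn k (-u) = dn k u := by
  simp [dn, sn_neg hk]

/-- This is the common denominator of the three addition theorems, which therefore hold for all real
arguments. -/
theorem one_sub_sq_mul_sn_sq_mul_sn_sq_pos (hk : k ^ 2 < 1) (u v : ℝ) :
    0 < 1 - k ^ 2 * sn k u ^ 2 * sn k v ^ 2 := by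
  have h1 : sn k u ^ 2 ≤ 1 := Real.sin_sq_le_one _
  have h2 : sn k v ^ 2 ≤ 1 := Real.sin_sq_le_one _
  have h3 : sn k u ^ 2 * sn k v ^ 2 ≤ 1 := mul_le_one₀ h1 (sq_nonneg _) h2
  nlinarith [sq_nonneg k, mul_nonneg (sq_nonneg (sn k u)) (sq_nonneg (sn k v))]

end Jacobi

/-! ### Lorentz numbers in null coordinates. -/

namespace LorentzNumber

theorem isInducing_re_im :
    IsInducing fun z : LorentzNumber => (z.re, z.im) := ⟨rfl⟩

theorem continuous_re : Continuous fun z : LorentzNumber => z.re :=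
  continuous_fst.comp isInducing_re_im.continuous

theorem continuous_im : Continuous fun z : LorentzNumber => z.im :=
  continuous_snd.comp isInducing_re_im.continuous

theorem hasSum_iff {ι : Type*} {f : ι → LorentzNumber} {z : LorentzNumber} :
    HasSum f z ↔ HasSum (fun i => (f i).re) z.re ∧ HasSum (fun i => (f i).im) z.im := by
  let g : LorentzNumber →+ ℝ × ℝ :=
    { toFun := fun z => (z.re, z.im), map_zero' := rfl, map_add' := fun _ _ => rfl }
  have h : IsInducing g := isInducing_re_im
  rw [← h.hasSum_iff]
  constructor
  · intro hs
    exact ⟨hs.map (AddMonoidHom.fst ℝ ℝ) continuous_fst,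
      hs.map (AddMonoidHom.snd ℝ ℝ) continuous_snd⟩
  · rintro ⟨h1, h2⟩
    exact h1.prodMk h2

/-- The null coordinates `re ± im` are multiplicative as well as additive, so power series over
$\mathbb L$ split into two real power series. -/
theorem hasSum_of_null {ι : Type*} {f : ι → LorentzNumber} {z : LorentzNumber}
    (h₁ : HasSum (fun i => (f i).re + (f i).im) (z.re + z.im))
    (h₂ : HasSum (fun i => (f i).re - (f i).im) (z.re - z.im)) : HasSum f z := by
  refine hasSum_iff.2 ⟨?_, ?_⟩
  · have e (w : LorentzNumber) : w.re = 1 / 2 * (w.re + w.im + (w.re - w.im)) := by ring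
    rw [e z, funext fun i => e (f i)]
    exact (h₁.add h₂).mul_left _
  · have e (w : LorentzNumber) : w.im = 1 / 2 * (w.re + w.im - (w.re - w.im)) := by ring
    rw [e z, funext fun i => e (f i)]
    exact (h₁.sub h₂).mul_left _

theorem re_add_im_mul (z w : LorentzNumber) :
    (z * w).re + (z * w).im = (z.re + z.im) * (w.re + w.im) := by
  simp; ring

theorem re_sub_im_mul (z w : LorentzNumber) :
    (z * w).re - (z * w).im = (z.re - z.im) * (w.re - w.im) := by
  simp; ring

theorem re_add_im_pow (z : LorentzNumber) (n : ℕ) :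
    (z ^ n).re + (z ^ n).im = (z.re + z.im) ^ n := by
  induction n with
  | zero => simp [QuadraticAlgebra.re_one, QuadraticAlgebra.im_one]
  | succ n ih => rw [pow_succ, re_add_im_mul, ih, pow_succ]

theorem re_sub_im_pow (z : LorentzNumber) (n : ℕ) :
    (z ^ n).re - (z ^ n).im = (z.re - z.im) ^ n := by
  induction n with
  | zero => simp [QuadraticAlgebra.re_one, QuadraticAlgebra.im_one]
  | succ n ih => rw [pow_succ, re_sub_im_mul, ih, pow_succ]

theorem extend_re (f : ℝ → ℝ) (z : LorentzNumber) :
    (extend f z).re = (f (z.re + z.im) + f (z.re - z.im)) / 2 := by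
  simp [extend, j, QuadraticAlgebra.re_one]; ring

theorem extend_im (f : ℝ → ℝ) (z : LorentzNumber) :
    (extend f z).im = (f (z.re + z.im) - f (z.re - z.im)) / 2 := by
  simp [extend, j, QuadraticAlgebra.im_one]; ring

theorem ext_null {z w : LorentzNumber} (h₁ : z.re + z.im = w.re + w.im)
    (h₂ : z.re - z.im = w.re - w.im) : z = w := by
  apply QuadraticAlgebra.ext <;> linarith

theorem extend_re_add_im (f : ℝ → ℝ) (z : LorentzNumber) :
    (extend f z).re + (extend f z).im = f (z.re + z.im) := by
  rw [extend_re, extend_im]; ring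

theorem extend_re_sub_im (f : ℝ → ℝ) (z : LorentzNumber) :
    (extend f z).re - (extend f z).im = f (z.re - z.im) := by
  rw [extend_re, extend_im]; ring

theorem extend_comp (f g : ℝ → ℝ) (z : LorentzNumber) :
    extend f (extend g z) = extend (fun t => f (g t)) z := by
  apply ext_null
  · simp only [extend_re_add_im]
  · simp only [extend_re_sub_im]

theorem smul_extend (r : ℝ) (f : ℝ → ℝ) (z : LorentzNumber) :
    r • extend f z = extend (fun t => r * f t) z := by
  apply QuadraticAlgebra.ext
  · simp only [QuadraticAlgebra.re_smul, extend_re, smul_eq_mul]; ring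
  · simp only [QuadraticAlgebra.im_smul, extend_im, smul_eq_mul]; ring

theorem isUnit_iff {z : LorentzNumber} : IsUnit z ↔ z.re + z.im ≠ 0 ∧ z.re - z.im ≠ 0 := by
  rw [QuadraticAlgebra.isUnit_iff_norm_isUnit, isUnit_iff_ne_zero, ← mul_ne_zero_iff,
    QuadraticAlgebra.norm_def]
  ring_nf

/-- Division acts separately on the two null coordinates. Invertibility of the denominator means
that both of its null coordinates are nonzero. -/
theorem extend_div_extend (f g : ℝ → ℝ) {z : LorentzNumber} (h : IsUnit (extend g z)) :
    extend f z / extend g z = extend (fun t => f t / g t) z := by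
  rw [isUnit_iff, extend_re_add_im, extend_re_sub_im] at h
  obtain ⟨h₁, h₂⟩ := h
  have hn : QuadraticAlgebra.norm (extend g z) = g (z.re + z.im) * g (z.re - z.im) := by
    rw [QuadraticAlgebra.norm_def, extend_re, extend_im]; ring
  have hdiv : extend f z / extend g z =
      extend f z * ((QuadraticAlgebra.norm (extend g z))⁻¹ • star (extend g z)) := rfl
  rw [hdiv, hn]
  apply ext_null
  · simp only [re_add_im_mul, QuadraticAlgebra.re_smul,
      QuadraticAlgebra.im_smul, QuadraticAlgebra.re_star, QuadraticAlgebra.im_star,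
      extend_re, extend_im, smul_eq_mul]
    field_simp
    ring
  · simp only [re_sub_im_mul, QuadraticAlgebra.re_smul,
      QuadraticAlgebra.im_smul, QuadraticAlgebra.re_star, QuadraticAlgebra.im_star,
      extend_re, extend_im, smul_eq_mul]
    field_simp
    ring

theorem isAnalyticExtension_extend {f : ℝ → ℝ} {I : Set ℝ} (hf : AnalyticOnNhd ℝ f I) :
    IsAnalyticExtension f I (extend f) := by
  refine ⟨fun z₀ hz₀ => ?_, fun t _ => ?_⟩
  · obtain ⟨α, hα⟩ := hf _ hz₀.1
    obtain ⟨β, hβ⟩ := hf _ hz₀.2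
    rw [hasFPowerSeriesAt_iff'] at hα hβ
    -- The Lorentz coefficient whose null coordinates are the Taylor coefficients of `f` at the two
    -- points `re ± im` of `z₀`.
    refine ⟨fun n => ⟨(α.coeff n + β.coeff n) / 2, (α.coeff n - β.coeff n) / 2⟩, ?_⟩
    filter_upwards [(continuous_re.add continuous_im).continuousAt.eventually hα,
      (continuous_re.sub continuous_im).continuousAt.eventually hβ] with z h₁ h₂
    apply hasSum_of_null
    · rw [extend_re_add_im]
      refine (congrArg (HasSum · _) (funext fun n => ?_)).mpr h₁
      rw [re_add_im_mul, re_add_im_pow, QuadraticAlgebra.re_sub, QuadraticAlgebra.im_sub,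
        smul_eq_mul]
      simp only [Pi.add_apply]
      ring
    · rw [extend_re_sub_im]
      refine (congrArg (HasSum · _) (funext fun n => ?_)).mpr h₂
      rw [re_sub_im_mul, re_sub_im_pow, QuadraticAlgebra.re_sub, QuadraticAlgebra.im_sub,
        smul_eq_mul]
      simp only [Pi.sub_apply]
      ring
  · apply QuadraticAlgebra.ext
    · rw [extend_re]; simp
    · rw [extend_im]; simp

end LorentzNumber

/-! ### Analyticity of arctan and artanh. -/

namespace Real

theorem analyticAt_arctan (x : ℝ) : AnalyticAt ℝ arctan x :=
  contDiff_arctan.contDiffAt.analyticAt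

theorem artanh_eventuallyEq {x : ℝ} (hx : x ∈ Ioo (-1) 1) :
    artanh =ᶠ[𝓝 x] fun y => 1 / 2 * log ((1 + y) / (1 - y)) := by
  filter_upwards [isOpen_Ioo.mem_nhds hx] with y hy
  exact artanh_eq_half_log (Ioo_subset_Icc_self hy)

theorem analyticAt_artanh {x : ℝ} (hx : x ∈ Ioo (-1) 1) : AnalyticAt ℝ artanh x := by
  have h₁ : 0 < 1 + x := by linarith [hx.1]
  have h₂ : 0 < 1 - x := by linarith [hx.2]
  refine AnalyticAt.congr ?_ (artanh_eventuallyEq hx).symm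
  exact analyticAt_const.mul (((analyticAt_const.add analyticAt_id).div
    (analyticAt_const.sub analyticAt_id) h₂.ne').log (div_pos h₁ h₂))

theorem hasDerivAt_artanh {x : ℝ} (hx : x ∈ Ioo (-1) 1) :
    HasDerivAt artanh (1 / (1 - x ^ 2)) x := by
  have h₁ : 0 < 1 + x := by linarith [hx.1]
  have h₂ : 0 < 1 - x := by linarith [hx.2]
  refine HasDerivAt.congr_of_eventuallyEq ?_ (artanh_eventuallyEq hx)
  refine HasDerivAt.congr_deriv (((((hasDerivAt_id x).const_add 1).div ((hasDerivAt_id x).const_sub 1) h₂.ne').log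
    (div_pos h₁ h₂).ne').const_mul (1 / 2 : ℝ)) ?_
  have h₃ : 1 - x ^ 2 ≠ 0 := by
    rw [show 1 - x ^ 2 = (1 + x) * (1 - x) by ring]; positivity
  simp only [id, Pi.div_apply]
  field_simp
  ring

end Real

/-! ### Addition theorems. -/

namespace Jacobi

variable {k : ℝ}

/-- With the sum `w` fixed, the right-hand side at `(t, w - t)` has zero derivative in `t`, a
polynomial identity modulo the relations for `cn ^ 2` and `dn ^ 2`. Its value at `t = w` is `sn k
w`. The same method gives `cn_add` and `dn_add`. -/
theorem sn_add (hk : k ^ 2 < 1) (u v : ℝ) :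
    sn k (u + v) = (sn k u * cn k v * dn k v + sn k v * cn k u * dn k u) /
      (1 - k ^ 2 * sn k u ^ 2 * sn k v ^ 2) := by
  set w := u + v with hw
  have hder (t : ℝ) : HasDerivAt (fun t => (sn k t * cn k (w - t) * dn k (w - t) + sn k (w - t) * cn k t * dn k t) /
      (1 - k ^ 2 * sn k t ^ 2 * sn k (w - t) ^ 2)) 0 t := by
    have hs := hasDerivAt_sn hk t
    have hc := hasDerivAt_cn hk t
    have hd := hasDerivAt_dn hk t
    have hs' := (hasDerivAt_sn hk (w - t)).comp_const_sub w t
    have hc' := (hasDerivAt_cn hk (w - t)).comp_const_sub w t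
    have hd' := (hasDerivAt_dn hk (w - t)).comp_const_sub w t
    have hΔ := (one_sub_sq_mul_sn_sq_mul_sn_sq_pos hk t (w - t)).ne'
    refine ((((hs.mul hc').mul hd').add ((hs'.mul hc).mul hd)).div
      ((((hs.pow 2).const_mul (k ^ 2)).mul (hs'.pow 2)).const_sub 1) hΔ).congr_deriv ?_
    rw [div_eq_zero_iff]
    left
    simp only [Pi.mul_apply, Pi.add_apply, Pi.pow_apply]
    have c1 := cn_sq k t
    have c2 := cn_sq k (w - t)
    have d1 := dn_sq hk t
    have d2 := dn_sq hk (w - t)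
    clear hs hc hd hs' hc' hd' hΔ hw
    generalize sn k t = S at *
    generalize cn k t = C at *
    generalize dn k t = D at *
    generalize sn k (w - t) = s at *
    generalize cn k (w - t) = c at *
    generalize dn k (w - t) = d at *
    grind
  have := is_const_of_deriv_eq_zero (fun t => (hder t).differentiableAt)
    (fun t => (hder t).deriv) w u
  simp only [sub_self, sn_zero hk, cn_zero hk, dn_zero hk] at this
  rw [show v = w - u by rw [hw]; ring, ← this]
  simp

theorem cn_add (hk : k ^ 2 < 1) (u v : ℝ) :
    cn k (u + v) = (cn k u * cn k v - sn k u * sn k v * dn k u * dn k v) /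
      (1 - k ^ 2 * sn k u ^ 2 * sn k v ^ 2) := by
  set w := u + v with hw
  have hder (t : ℝ) : HasDerivAt (fun t => (cn k t * cn k (w - t) - sn k t * sn k (w - t) * dn k t * dn k (w - t)) /
      (1 - k ^ 2 * sn k t ^ 2 * sn k (w - t) ^ 2)) 0 t := by
    have hs := hasDerivAt_sn hk t
    have hc := hasDerivAt_cn hk t
    have hd := hasDerivAt_dn hk t
    have hs' := (hasDerivAt_sn hk (w - t)).comp_const_sub w t
    have hc' := (hasDerivAt_cn hk (w - t)).comp_const_sub w t
    have hd' := (hasDerivAt_dn hk (w - t)).comp_const_sub w t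
    have hΔ := (one_sub_sq_mul_sn_sq_mul_sn_sq_pos hk t (w - t)).ne'
    refine (((hc.mul hc').sub (((hs.mul hs').mul hd).mul hd')).div
      ((((hs.pow 2).const_mul (k ^ 2)).mul (hs'.pow 2)).const_sub 1) hΔ).congr_deriv ?_
    rw [div_eq_zero_iff]
    left
    simp only [Pi.mul_apply, Pi.sub_apply, Pi.pow_apply]
    have c1 := cn_sq k t
    have c2 := cn_sq k (w - t)
    have d1 := dn_sq hk t
    have d2 := dn_sq hk (w - t)
    clear hs hc hd hs' hc' hd' hΔ hw
    generalize sn k t = S at *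
    generalize cn k t = C at *
    generalize dn k t = D at *
    generalize sn k (w - t) = s at *
    generalize cn k (w - t) = c at *
    generalize dn k (w - t) = d at *
    grind
  have := is_const_of_deriv_eq_zero (fun t => (hder t).differentiableAt)
    (fun t => (hder t).deriv) w u
  simp only [sub_self, sn_zero hk, cn_zero hk, dn_zero hk] at this
  rw [show v = w - u by rw [hw]; ring, ← this]
  simp

theorem dn_add (hk : k ^ 2 < 1) (u v : ℝ) :
    dn k (u + v) = (dn k u * dn k v - k ^ 2 * sn k u * sn k v * cn k u * cn k v) /
      (1 - k ^ 2 * sn k u ^ 2 * sn k v ^ 2) := by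
  set w := u + v with hw
  have hder (t : ℝ) : HasDerivAt (fun t => (dn k t * dn k (w - t) - k ^ 2 * sn k t * sn k (w - t) * cn k t * cn k (w - t)) /
      (1 - k ^ 2 * sn k t ^ 2 * sn k (w - t) ^ 2)) 0 t := by
    have hs := hasDerivAt_sn hk t
    have hc := hasDerivAt_cn hk t
    have hd := hasDerivAt_dn hk t
    have hs' := (hasDerivAt_sn hk (w - t)).comp_const_sub w t
    have hc' := (hasDerivAt_cn hk (w - t)).comp_const_sub w t
    have hd' := (hasDerivAt_dn hk (w - t)).comp_const_sub w t
    have hΔ := (one_sub_sq_mul_sn_sq_mul_sn_sq_pos hk t (w - t)).ne'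
    refine (((hd.mul hd').sub ((((hs.const_mul (k ^ 2)).mul hs').mul hc).mul hc')).div
      ((((hs.pow 2).const_mul (k ^ 2)).mul (hs'.pow 2)).const_sub 1) hΔ).congr_deriv ?_
    rw [div_eq_zero_iff]
    left
    simp only [Pi.mul_apply, Pi.sub_apply, Pi.pow_apply]
    have c1 := cn_sq k t
    have c2 := cn_sq k (w - t)
    have d1 := dn_sq hk t
    have d2 := dn_sq hk (w - t)
    clear hs hc hd hs' hc' hd' hΔ hw
    generalize sn k t = S at *
    generalize cn k t = C at *
    generalize dn k t = D at *
    generalize sn k (w - t) = s at *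
    generalize cn k (w - t) = c at *
    generalize dn k (w - t) = d at *
    grind
  have := is_const_of_deriv_eq_zero (fun t => (hder t).differentiableAt)
    (fun t => (hder t).deriv) w u
  simp only [sub_self, sn_zero hk, cn_zero hk, dn_zero hk] at this
  rw [show v = w - u by rw [hw]; ring, ← this]
  simp

end Jacobi

/-! ### Partial derivatives and the duality criterion. -/

theorem partialU_eq_of_hasDerivAt {x : ℝ × ℝ → E3} {w : ℝ × ℝ} {d : E3}
    (hx : DifferentiableAt ℝ x w) (h : HasDerivAt (fun t => x (t, w.2)) d w.1) :
    partialU x w = d := by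
  have hc : HasDerivAt (fun t : ℝ => (t, w.2)) ((1, 0) : ℝ × ℝ) w.1 :=
    (hasDerivAt_id w.1).prodMk (hasDerivAt_const w.1 w.2)
  exact (HasFDerivAt.comp_hasDerivAt w.1 (l := x) hx.hasFDerivAt hc).unique h

theorem partialV_eq_of_hasDerivAt {x : ℝ × ℝ → E3} {w : ℝ × ℝ} {d : E3}
    (hx : DifferentiableAt ℝ x w) (h : HasDerivAt (fun t => x (w.1, t)) d w.2) :
    partialV x w = d := by
  have hc : HasDerivAt (fun t : ℝ => (w.1, t)) ((0, 1) : ℝ × ℝ) w.2 :=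
    (hasDerivAt_const w.2 w.1).prodMk (hasDerivAt_id w.2)
  exact (HasFDerivAt.comp_hasDerivAt w.2 (l := x) hx.hasFDerivAt hc).unique h

theorem HasDerivAt.vec3 {f g h : ℝ → ℝ} {f' g' h' t : ℝ} (hf : HasDerivAt f f' t)
    (hg : HasDerivAt g g' t) (hh : HasDerivAt h h' t) :
    HasDerivAt (fun t => (!₂[f t, g t, h t] : E3)) !₂[f', g', h'] t := by
  have : HasDerivAt (fun t => ![f t, g t, h t]) ![f', g', h'] t := by
    rw [hasDerivAt_pi]
    intro i
    fin_cases i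
    exacts [hf, hg, hh]
  exact (PiLp.continuousLinearEquiv 2 ℝ (fun _ : Fin 3 => ℝ)).symm.toContinuousLinearMap
    |>.hasFDerivAt.comp_hasDerivAt t this

theorem ContDiffOn.vec3 {f g h : ℝ × ℝ → ℝ} {U : Set (ℝ × ℝ)} {n : ℕ∞ω}
    (hf : ContDiffOn ℝ n f U) (hg : ContDiffOn ℝ n g U) (hh : ContDiffOn ℝ n h U) :
    ContDiffOn ℝ n (fun w => (!₂[f w, g w, h w] : E3)) U := by
  rw [contDiffOn_euclidean]
  intro i
  fin_cases i
  exacts [hf, hg, hh]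

theorem inner_vec3 (x y : E3) : inner ℝ x y = x 0 * y 0 + x 1 * y 1 + x 2 * y 2 := by
  simp [PiLp.inner_apply, Fin.sum_univ_three, mul_comm]

theorem linearIndependent_pair_of_inner_eq_zero {x y : E3} (hx : x ≠ 0) (hy : y ≠ 0)
    (h : inner ℝ x y = 0) : LinearIndependent ℝ ![x, y] := by
  refine linearIndependent_of_ne_zero_of_inner_eq_zero (𝕜 := ℝ) ?_ ?_
  · intro i
    fin_cases i
    exacts [hx, hy]
  · intro i j hij
    fin_cases i <;> fin_cases j
    · exact absurd rfl hij
    · exact h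
    · simpa [real_inner_comm] using h
    · exact absurd rfl hij

theorem IsSurfacePatch.mono {U V : Set (ℝ × ℝ)} {x : ℝ × ℝ → E3} (h : IsSurfacePatch U x)
    (hV : IsOpen V) (hVU : V ⊆ U) : IsSurfacePatch V x :=
  ⟨hV, h.2.1.mono hVU, fun w hw => h.2.2 w (hVU hw)⟩

theorem IsCurvatureLineParam.mono {U V : Set (ℝ × ℝ)} {x : ℝ × ℝ → E3}
    (h : IsCurvatureLineParam U x) (hV : IsOpen V) (hVU : V ⊆ U) : IsCurvatureLineParam V x :=
  ⟨h.1.mono hV hVU, fun w hw => h.2 w (hVU hw)⟩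

/-- The only second-order point is conjugacy: differentiating $y_u=-r\,x_u$ in $v$ adds a multiple
of $x_u$, which the determinant does not see. -/
theorem isCurvatureLineParam_and_isChristoffelDual_of_smul {U : Set (ℝ × ℝ)}
    {x y : ℝ × ℝ → E3} {r : ℝ × ℝ → ℝ} (hx : IsCurvatureLineParam U x)
    (hy : ContDiffOn ℝ ∞ y U) (hr : ∀ w ∈ U, 0 < r w) (hrd : ∀ w ∈ U, DifferentiableAt ℝ r w)
    (hu : ∀ w ∈ U, partialU y w = -r w • partialU x w)
    (hv : ∀ w ∈ U, partialV y w = r w • partialV x w) :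
    IsCurvatureLineParam U y ∧ IsChristoffelDual U x y := by
  have hU := hx.1.1
  have hxne (w) (hw : w ∈ U) : partialU x w ≠ 0 ∧ partialV x w ≠ 0 :=
    ⟨(hx.1.2.2 w hw).ne_zero 0, (hx.1.2.2 w hw).ne_zero 1⟩
  have hinner (w) (hw : w ∈ U) : inner ℝ (partialU y w) (partialV y w) = 0 := by
    rw [hu w hw, hv w hw, inner_smul_left, inner_smul_right, (hx.2 w hw).1]
    simp
  have hpatch : IsSurfacePatch U y := by
    refine ⟨hU, hy, fun w hw => ?_⟩
    refine linearIndependent_pair_of_inner_eq_zero ?_ ?_ (hinner w hw)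
    · rw [hu w hw]
      exact smul_ne_zero (neg_ne_zero.2 (hr w hw).ne') (hxne w hw).1
    · rw [hv w hw]
      exact smul_ne_zero (hr w hw).ne' (hxne w hw).2
  refine ⟨⟨hpatch, fun w hw => ⟨hinner w hw, ?_⟩⟩, hx.1, hpatch, fun w hw => ⟨?_, ?_⟩⟩
  · have hxd : DifferentiableAt ℝ (partialU x) w := by
      have h1 : ContDiffAt ℝ ∞ x w := hx.1.2.1.contDiffAt (hU.mem_nhds hw)
      have h2 : DifferentiableAt ℝ (fderiv ℝ x) w :=
        (h1.fderiv_right (m := 1) (by norm_cast)).differentiableAt (by norm_num)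
      exact h2.clm_apply (differentiableAt_const _)
    have hev : partialU y =ᶠ[𝓝 w] fun w => -r w • partialU x w := by
      filter_upwards [hU.mem_nhds hw] with w' hw' using hu w' hw'
    have hyuv : partialV (partialU y) w =
        -r w • partialV (partialU x) w + (-fderiv ℝ r w (0, 1)) • partialU x w := by
      have h := ((hrd w hw).hasFDerivAt.neg.smul hxd.hasFDerivAt).fderiv
      rw [partialV, hev.fderiv_eq]
      change fderiv ℝ (-r • partialU x) w (0, 1) = _
      rw [h]
      simp [partialV]
    have hdet := (hx.2 w hw).2
    rw [hyuv, hu w hw, hv w hw]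
    simp only [Matrix.det_fin_three, Matrix.of_apply, Matrix.cons_val, WithLp.ofLp_add,
      WithLp.ofLp_smul, Pi.add_apply, Pi.smul_apply, smul_eq_mul] at hdet ⊢
    -- The three rows contribute the factors `-r`, `-r` and `r`.
    linear_combination (r w) ^ 3 * hdet
  · refine ⟨-r w, 0, 0, r w, by simp [hu w hw], by simp [hv w hw], ?_⟩
    nlinarith [hr w hw]
  · refine ⟨r w ^ 2, pow_pos (hr w hw) 2, ?_, ?_, ?_⟩
    · rw [hu w hw, inner_smul_left, inner_smul_right]
      simp; ring
    · rw [hinner w hw, (hx.2 w hw).1, mul_zero]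
    · rw [hv w hw, inner_smul_left, inner_smul_right]
      simp; ring

/-! ### Curvature lines of the hyperboloid. -/

namespace Jacobi

theorem contDiff_sn {k : ℝ} (hk : k ^ 2 < 1) {n : ℕ∞ω} : ContDiff ℝ n (sn k) :=
  contDiff_iff_contDiffAt.2 fun u => (analyticAt_sn hk u).contDiffAt

theorem contDiff_cn {k : ℝ} (hk : k ^ 2 < 1) {n : ℕ∞ω} : ContDiff ℝ n (cn k) :=
  contDiff_iff_contDiffAt.2 fun u => (analyticAt_cn hk u).contDiffAt

theorem contDiff_dn {k : ℝ} (hk : k ^ 2 < 1) {n : ℕ∞ω} : ContDiff ℝ n (dn k) :=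
  contDiff_iff_contDiffAt.2 fun u => (analyticAt_dn hk u).contDiffAt

end Jacobi

namespace Hyperboloid

open Jacobi LorentzNumber

variable {a b c p q : ℝ}

theorem isOpen_domain (hq : q ^ 2 < 1) : IsOpen (domain q) :=
  isOpen_ne_fun ((contDiff_sn hq (n := 0)).continuous.comp continuous_fst) continuous_const

theorem param_apply (a b c q : ℝ) (w : ℝ × ℝ) :
    param a b c q w = !₂[a * cn q w.1 / sn q w.1 / dn q w.2,
      -b * sn q w.2 * dn q w.1 / sn q w.1 / dn q w.2, c * cn q w.2 / sn q w.1 / dn q w.2] := by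
  ext i
  fin_cases i <;> simp [param] <;> ring

theorem contDiffOn_param (hq : q ^ 2 < 1) : ContDiffOn ℝ ∞ (param a b c q) (domain q) := by
  rw [show param a b c q = _ from funext (param_apply a b c q)]
  have hS : ContDiffOn ℝ ∞ (fun w : ℝ × ℝ => sn q w.1) (domain q) :=
    ((contDiff_sn hq).comp contDiff_fst).contDiffOn
  have hC : ContDiffOn ℝ ∞ (fun w : ℝ × ℝ => cn q w.1) (domain q) :=
    ((contDiff_cn hq).comp contDiff_fst).contDiffOn
  have hD : ContDiffOn ℝ ∞ (fun w : ℝ × ℝ => dn q w.1) (domain q) :=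
    ((contDiff_dn hq).comp contDiff_fst).contDiffOn
  have hs : ContDiffOn ℝ ∞ (fun w : ℝ × ℝ => sn q w.2) (domain q) :=
    ((contDiff_sn hq).comp contDiff_snd).contDiffOn
  have hc : ContDiffOn ℝ ∞ (fun w : ℝ × ℝ => cn q w.2) (domain q) :=
    ((contDiff_cn hq).comp contDiff_snd).contDiffOn
  have hd : ContDiffOn ℝ ∞ (fun w : ℝ × ℝ => dn q w.2) (domain q) :=
    ((contDiff_dn hq).comp contDiff_snd).contDiffOn
  have h1 : ∀ w ∈ domain q, sn q w.1 ≠ 0 := fun w hw => hw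
  have h2 : ∀ w ∈ domain q, dn q w.2 ≠ 0 := fun w _ => (dn_pos hq _).ne'
  exact (((contDiffOn_const.mul hC).div hS h1).div hd h2).vec3
    ((((contDiffOn_const.mul hs).mul hD).div hS h1).div hd h2)
    (((contDiffOn_const.mul hc).div hS h1).div hd h2)

theorem differentiableAt_param (hq : q ^ 2 < 1) {w : ℝ × ℝ} (hw : w ∈ domain q) :
    DifferentiableAt ℝ (param a b c q) w :=
  ((contDiffOn_param hq).contDiffAt ((isOpen_domain hq).mem_nhds hw)).differentiableAt (by simp)

theorem partialU_param (hq : q ^ 2 < 1) {w : ℝ × ℝ} (hw : w ∈ domain q) :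
    partialU (param a b c q) w = !₂[-a * dn q w.1 / sn q w.1 ^ 2 / dn q w.2,
      b * sn q w.2 * cn q w.1 / sn q w.1 ^ 2 / dn q w.2,
      -c * cn q w.2 * cn q w.1 * dn q w.1 / sn q w.1 ^ 2 / dn q w.2] := by
  refine partialU_eq_of_hasDerivAt (differentiableAt_param hq hw) ?_
  simp only [param_apply]
  have hS := hasDerivAt_sn hq w.1
  have hC := hasDerivAt_cn hq w.1
  have hD := hasDerivAt_dn hq w.1
  have h0 : sn q w.1 ≠ 0 := hw
  have h1 := (dn_pos hq w.2).ne'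
  have hc := cn_sq q w.1
  have hd := dn_sq hq w.1
  refine HasDerivAt.vec3 (HasDerivAt.congr_deriv (((hC.const_mul a).div hS h0).div_const _) ?_)
    (HasDerivAt.congr_deriv (((hD.const_mul (-b * sn q w.2)).div hS h0).div_const _) ?_)
    (HasDerivAt.congr_deriv (((hasDerivAt_const w.1 (c * cn q w.2)).div hS h0).div_const _) ?_)
  · field_simp
    linear_combination -a * dn q w.1 * hc
  · field_simp
    linear_combination b * sn q w.2 * cn q w.1 * hd
  · field_simp
    ring

theorem partialV_param (hq : q ^ 2 < 1) {w : ℝ × ℝ} (hw : w ∈ domain q) :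
    partialV (param a b c q) w = !₂[a * q ^ 2 * cn q w.1 * sn q w.2 * cn q w.2 / sn q w.1 /
        dn q w.2 ^ 2,
      -b * dn q w.1 * cn q w.2 / sn q w.1 / dn q w.2 ^ 2,
      -c * (1 - q ^ 2) * sn q w.2 / sn q w.1 / dn q w.2 ^ 2] := by
  refine partialV_eq_of_hasDerivAt (differentiableAt_param hq hw) ?_
  simp only [param_apply]
  have hS := hasDerivAt_sn hq w.2
  have hC := hasDerivAt_cn hq w.2
  have hD := hasDerivAt_dn hq w.2
  have h0 : sn q w.1 ≠ 0 := hw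
  have h1 := (dn_pos hq w.2).ne'
  have hc := cn_sq q w.2
  have hd := dn_sq hq w.2
  refine HasDerivAt.vec3
    (HasDerivAt.congr_deriv ((hasDerivAt_const w.2 (a * cn q w.1 / sn q w.1)).div hD h1) ?_)
    (HasDerivAt.congr_deriv
      ((((hS.const_mul (-b)).mul_const (dn q w.1)).div_const (sn q w.1)).div hD h1) ?_)
    (HasDerivAt.congr_deriv (((hC.const_mul c).div_const (sn q w.1)).div hD h1) ?_)
  · field_simp
    ring
  · field_simp
    linear_combination -b * cn q w.2 * dn q w.1 * hd
  · field_simp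
    linear_combination c * sn q w.2 * (-hd + q ^ 2 * hc)

theorem partialV_partialU_param (hq : q ^ 2 < 1) {w : ℝ × ℝ} (hw : w ∈ domain q) :
    partialV (partialU (param a b c q)) w = !₂[-a * q ^ 2 * dn q w.1 * sn q w.2 * cn q w.2 /
        sn q w.1 ^ 2 / dn q w.2 ^ 2,
      b * cn q w.1 * cn q w.2 / sn q w.1 ^ 2 / dn q w.2 ^ 2,
      c * (1 - q ^ 2) * cn q w.1 * dn q w.1 * sn q w.2 / sn q w.1 ^ 2 / dn q w.2 ^ 2] := by
  have hdiff : DifferentiableAt ℝ (partialU (param a b c q)) w := by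
    have h1 : ContDiffAt ℝ ∞ (param a b c q) w :=
      (contDiffOn_param hq).contDiffAt ((isOpen_domain hq).mem_nhds hw)
    have h2 : DifferentiableAt ℝ (fderiv ℝ (param a b c q)) w :=
      (h1.fderiv_right (m := 1) (by norm_cast)).differentiableAt (by norm_num)
    exact h2.clm_apply (differentiableAt_const _)
  refine partialV_eq_of_hasDerivAt hdiff ?_
  -- `domain` restricts only `u`, so the formula for `partialU` is valid along the whole line `(w.1,
  -- t)`.
  simp only [fun t => partialU_param (a := a) (b := b) (c := c) hq (w := (w.1, t)) hw]
  have hS := hasDerivAt_sn hq w.2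
  have hC := hasDerivAt_cn hq w.2
  have hD := hasDerivAt_dn hq w.2
  have h0 : sn q w.1 ≠ 0 := hw
  have h1 := (dn_pos hq w.2).ne'
  have hc := cn_sq q w.2
  have hd := dn_sq hq w.2
  refine HasDerivAt.vec3
    (HasDerivAt.congr_deriv
      ((hasDerivAt_const w.2 (-a * dn q w.1 / sn q w.1 ^ 2)).div hD h1) ?_)
    (HasDerivAt.congr_deriv
      ((((hS.const_mul b).mul_const (cn q w.1)).div_const (sn q w.1 ^ 2)).div hD h1) ?_)
    (HasDerivAt.congr_deriv ((((hC.const_mul (-c)).mul_const (cn q w.1)).mul_const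
      (dn q w.1)).div_const (sn q w.1 ^ 2) |>.div hD h1) ?_)
  · field_simp
    ring
  · field_simp
    linear_combination b * cn q w.2 * cn q w.1 * hd
  · field_simp
    linear_combination c * sn q w.2 * cn q w.1 * dn q w.1 * (hd - q ^ 2 * hc)

theorem isCurvatureLineParam_param (ha : 0 < a) (hb : 0 < b) (hc : 0 < c) (hq : q ^ 2 < 1)
    (habc : q ^ 2 * (a ^ 2 + c ^ 2) = c ^ 2 - b ^ 2) :
    IsCurvatureLineParam (domain q) (param a b c q) := by
  have hinner (w) (hw : w ∈ domain q) :
      inner ℝ (partialU (param a b c q) w) (partialV (param a b c q) w) = 0 := by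
    rw [partialU_param hq hw, partialV_param hq hw, inner_vec3]
    simp only [Matrix.cons_val]
    linear_combination (-dn q w.1 * cn q w.1 * sn q w.2 * cn q w.2 / sn q w.1 ^ 3 /
      dn q w.2 ^ 3) * habc
  refine ⟨⟨isOpen_domain hq, contDiffOn_param hq, fun w hw => ?_⟩,
    fun w hw => ⟨hinner w hw, ?_⟩⟩
  · have hS : sn q w.1 ≠ 0 := hw
    have hD := (dn_pos hq w.1).ne'
    have hd := (dn_pos hq w.2).ne'
    refine linearIndependent_pair_of_inner_eq_zero (fun h => ?_) (fun h => ?_) (hinner w hw)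
    · have h0 := congrArg (fun x : E3 => x 0) h
      rw [partialU_param hq hw] at h0
      simp [ha.ne', hS, hD, hd] at h0
    · have h1 := congrArg (fun x : E3 => x 1) h
      have h2 := congrArg (fun x : E3 => x 2) h
      rw [partialV_param hq hw] at h1 h2
      simp [hb.ne', hc.ne', hS, hD, hd, (sub_pos.2 hq).ne'] at h1 h2
      -- If the last two components of $x_v$ vanished, then `cn` and `sn` would both be zero at `v`.
      have := cn_sq q w.2
      rw [h1, h2] at this
      norm_num at this
  · rw [partialV_partialU_param hq hw, partialU_param hq hw, partialV_param hq hw]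
    simp only [Matrix.det_fin_three, Matrix.of_apply, Matrix.cons_val]
    have c1 := cn_sq q w.1
    have c2 := cn_sq q w.2
    have d1 := dn_sq hq w.1
    linear_combination a * b * c * cn q w.1 * dn q w.1 * sn q w.2 * cn q w.2 / sn q w.1 ^ 5 /
      dn q w.2 ^ 5 * ((q ^ 2 * cn q w.2 ^ 2 + (1 - q ^ 2)) * d1 - (q ^ 2 * cn q w.2 ^ 2 +
      (1 - q ^ 2) * q ^ 2 * sn q w.2 ^ 2) * c1 + (1 - q ^ 2) * q ^ 2 * sn q w.1 ^ 2 * c2)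

end Hyperboloid

/-! ### Shift by the complete integral, and the image of the parametrization. -/

namespace Jacobi

variable {k : ℝ}

/-- The complete elliptic integral of the first kind. -/
noncomputable def ellipticK (k : ℝ) : ℝ := ellipticF k (Real.pi / 2)

theorem am_ellipticK (hk : k ^ 2 < 1) : am k (ellipticK k) = Real.pi / 2 := am_ellipticF hk _

theorem sn_ellipticK (hk : k ^ 2 < 1) : sn k (ellipticK k) = 1 := by
  rw [sn, am_ellipticK hk, Real.sin_pi_div_two]

theorem cn_ellipticK (hk : k ^ 2 < 1) : cn k (ellipticK k) = 0 := by
  rw [cn, am_ellipticK hk, Real.cos_pi_div_two]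

theorem dn_ellipticK (hk : k ^ 2 < 1) : dn k (ellipticK k) = √(1 - k ^ 2) := by
  rw [dn, sn_ellipticK hk, one_pow, mul_one]

theorem ellipticK_nonneg (hk : k ^ 2 < 1) : 0 ≤ ellipticK k := by
  rw [← ellipticF_zero (k := k)]
  exact (strictMono_ellipticF hk).monotone (by positivity)

/-- The amplitude takes every real value, so `(cn, sn)` covers the unit circle; `Complex.arg`
supplies the angle. -/
theorem exists_sn_eq_cn_eq (hk : k ^ 2 < 1) {s c : ℝ} (h : c ^ 2 + s ^ 2 = 1) :
    ∃ u, sn k u = s ∧ cn k u = c := by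
  have hz : ‖(⟨c, s⟩ : ℂ)‖ = 1 := by
    rw [Complex.norm_def, Complex.normSq_mk, show c * c + s * s = 1 by linarith, Real.sqrt_one]
  have hne : (⟨c, s⟩ : ℂ) ≠ 0 := norm_ne_zero_iff.1 (by rw [hz]; norm_num)
  refine ⟨ellipticF k (Complex.arg ⟨c, s⟩), ?_, ?_⟩
  · rw [sn, am_ellipticF hk, Complex.sin_arg, hz, div_one]
  · rw [cn, am_ellipticF hk, Complex.cos_arg hne, hz, div_one]

theorem sn_add_ellipticK (hk : k ^ 2 < 1) (u : ℝ) :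
    sn k (u + ellipticK k) = cn k u / dn k u := by
  have := (dn_pos hk u).ne'
  rw [sn_add hk, sn_ellipticK hk, cn_ellipticK hk, one_pow, mul_one, ← dn_sq hk]
  field_simp
  ring

theorem cn_add_ellipticK (hk : k ^ 2 < 1) (u : ℝ) :
    cn k (u + ellipticK k) = -√(1 - k ^ 2) * sn k u / dn k u := by
  have := (dn_pos hk u).ne'
  rw [cn_add hk, sn_ellipticK hk, cn_ellipticK hk, dn_ellipticK hk, one_pow,
    mul_one (k ^ 2 * sn k u ^ 2), ← dn_sq hk]
  field_simp
  ring

theorem dn_add_ellipticK (hk : k ^ 2 < 1) (u : ℝ) :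
    dn k (u + ellipticK k) = √(1 - k ^ 2) / dn k u := by
  have := (dn_pos hk u).ne'
  rw [dn_add hk, sn_ellipticK hk, cn_ellipticK hk, dn_ellipticK hk, one_pow,
    mul_one (k ^ 2 * sn k u ^ 2), ← dn_sq hk]
  field_simp
  ring

end Jacobi

namespace Hyperboloid

open Jacobi LorentzNumber

variable {a b c p q : ℝ}

theorem param_mem_surface (ha : 0 < a) (hb : 0 < b) (hc : 0 < c) (hq : q ^ 2 < 1) {w : ℝ × ℝ}
    (hw : w ∈ domain q) : param a b c q w ∈ surface a b c := by
  have hS : sn q w.1 ≠ 0 := hw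
  have hd := (dn_pos hq w.2).ne'
  have c1 := cn_sq q w.1
  have c2 := cn_sq q w.2
  have d1 := dn_sq hq w.1
  have d2 := dn_sq hq w.2
  rw [param_apply, surface, mem_ofPred_eq]
  simp only [Matrix.cons_val]
  field_simp
  linear_combination sn q w.1 ^ 2 * d2 + c1 - sn q w.2 ^ 2 * d1 - c2

/-- The first coordinate forces $\mathrm{cn}\,u/\mathrm{sn}\,u=X\,\mathrm{dn}\,v$. With
$\mathrm{sn}\,u>0$ this determines the second coordinate as a function of $v$ alone, which is solved
by the intermediate value theorem; the equation of the surface then gives the third up to sign. -/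
theorem image_param (ha : 0 < a) (hb : 0 < b) (hc : 0 < c) (hq : q ^ 2 < 1) :
    param a b c q '' domain q = surface a b c := by
  refine Subset.antisymm (image_subset_iff.2 fun w hw => param_mem_surface ha hb hc hq hw) ?_
  intro x hx
  have hx' : 1 + (x 0 / a) ^ 2 = (x 1 / b) ^ 2 + (x 2 / c) ^ 2 := hx
  set X := x 0 / a with hX
  set Y := x 1 / b with hY
  set Z := x 2 / c with hZ
  have hp : 0 < 1 - q ^ 2 := sub_pos.2 hq
  -- Since $\mathrm{dn}^2u/\mathrm{sn}^2u=1-q^2+(\mathrm{cn}\,u/\mathrm{sn}\,u)^2$, this is the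
  -- second coordinate divided by `b`. At $v=\pm K$ it takes the values $\mp\sqrt{1+X^2}$, the
  -- extreme values that the surface equation allows for `Y`.
  set g : ℝ → ℝ := fun v => -sn q v * √(X ^ 2 * dn q v ^ 2 + (1 - q ^ 2)) / dn q v with hg
  have hcont : Continuous g := by
    have h1 : Continuous (sn q) := (contDiff_sn hq (n := 0)).continuous
    have h2 : Continuous (dn q) := (contDiff_dn hq (n := 0)).continuous
    exact (h1.neg.mul (by fun_prop)).div h2 fun v => (dn_pos hq v).ne'
  have hK : g (ellipticK q) = -√(1 + X ^ 2) := by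
    simp only [hg, sn_ellipticK hq, dn_ellipticK hq, Real.sq_sqrt hp.le]
    rw [show X ^ 2 * (1 - q ^ 2) + (1 - q ^ 2) = (1 - q ^ 2) * (1 + X ^ 2) by ring,
      Real.sqrt_mul hp.le]
    have := (Real.sqrt_pos.2 hp).ne'
    field_simp
  have hK' : g (-ellipticK q) = √(1 + X ^ 2) := by
    have : g (-ellipticK q) = -g (ellipticK q) := by
      simp only [hg, sn_neg hq, dn_neg hq]
      ring
    rw [this, hK, neg_neg]
  have hY : |Y| ≤ √(1 + X ^ 2) := Real.abs_le_sqrt (by nlinarith [sq_nonneg Z])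
  obtain ⟨v₀, -, hv₀⟩ := intermediate_value_Icc' (neg_le_self (ellipticK_nonneg hq))
    hcont.continuousOn (show Y ∈ Icc (g (ellipticK q)) (g (-ellipticK q)) by
      rw [hK, hK']; exact abs_le.1 hY)
  -- the two solutions with the same `sn` differ by the sign of `cn`
  obtain ⟨v, hv, hcn⟩ : ∃ v, g v = Y ∧ 0 ≤ cn q v * Z := by
    rcases le_total 0 (cn q v₀ * Z) with h | h
    · exact ⟨v₀, hv₀, h⟩
    · obtain ⟨v, h1, h2⟩ := exists_sn_eq_cn_eq hq (s := sn q v₀) (c := -cn q v₀)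
        (by rw [neg_sq, cn_sq]; ring)
      refine ⟨v, ?_, by rw [h2]; linarith⟩
      have h3 : dn q v = dn q v₀ := by rw [dn, dn, h1]
      rw [← hv₀]
      simp only [hg, h1, h3]
  set t := X * dn q v with ht
  have htpos : 0 < 1 + t ^ 2 := by positivity
  have hsq := (Real.sqrt_pos.2 htpos)
  -- The point of the unit circle with cotangent `t` and positive sine.
  obtain ⟨u, hsn, hcu⟩ := exists_sn_eq_cn_eq hq (s := 1 / √(1 + t ^ 2)) (c := t / √(1 + t ^ 2))
    (by rw [div_pow, div_pow, Real.sq_sqrt htpos.le]; field_simp; ring)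
  have hw : (u, v) ∈ domain q := by
    change sn q u ≠ 0
    rw [hsn]; positivity
  have hdu : dn q u = √(X ^ 2 * dn q v ^ 2 + (1 - q ^ 2)) / √(1 + t ^ 2) := by
    rw [dn, hsn, ← Real.sqrt_div' _ htpos.le, div_pow, Real.sq_sqrt htpos.le]
    congr 1
    field_simp
    rw [ht]; ring
  have hdv := dn_pos hq v
  have h0 : param a b c q (u, v) 0 = x 0 := by
    rw [param_apply]
    simp only [Matrix.cons_val, hsn, hcu]
    rw [show x 0 = a * X by rw [hX]; field_simp]
    field_simp
    rw [ht, mul_comm]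
  have h1 : param a b c q (u, v) 1 = x 1 := by
    rw [param_apply]
    simp only [Matrix.cons_val, hsn, hdu]
    rw [show x 1 = b * Y from (mul_div_cancel₀ _ hb.ne').symm, ← hv]
    simp only [hg]
    field_simp
  have h2 : param a b c q (u, v) 2 = x 2 := by
    have hmem : 1 + (param a b c q (u, v) 0 / a) ^ 2 = (param a b c q (u, v) 1 / b) ^ 2 +
      (param a b c q (u, v) 2 / c) ^ 2 := param_mem_surface ha hb hc hq hw
    rw [h0, h1] at hmem
    have hval : param a b c q (u, v) 2 / c = cn q v * (√(1 + t ^ 2) / dn q v) := by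
      rw [param_apply]
      simp only [Matrix.cons_val, hsn]
      field_simp
    have hsq2 : (param a b c q (u, v) 2 / c) ^ 2 = Z ^ 2 := by
      linarith
    have hsign : 0 ≤ (param a b c q (u, v) 2 / c) * Z := by
      rw [hval, mul_right_comm]
      exact mul_nonneg hcn (by positivity)
    have heq : param a b c q (u, v) 2 / c = Z := by
      rcases sq_eq_sq_iff_eq_or_eq_neg.1 hsq2 with h | h
      · exact h
      · rw [h] at hsign ⊢
        have : Z = 0 := by nlinarith [sq_nonneg Z]
        simp [this]
    rw [hZ] at heq
    exact (div_left_inj' hc.ne').1 heq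
  refine ⟨(u, v), hw, ?_⟩
  ext i
  fin_cases i
  exacts [h0, h1, h2]

end Hyperboloid

/-! ### The dual surface. -/

namespace Hyperboloid

open Jacobi LorentzNumber

variable {a b c p q : ℝ}

theorem mul_sn_mem_Ioo (hq : q ^ 2 < 1) (t : ℝ) : q * sn q t ∈ Ioo (-1 : ℝ) 1 := by
  rw [mem_Ioo, ← abs_lt, ← sq_lt_one_iff_abs_lt_one, mul_pow]
  exact sub_pos.1 (one_sub_sq_mul_sin_sq_pos hq (am q t))

theorem contDiffAt_arctan_cn (hq : q ^ 2 < 1) (t : ℝ) {n : ℕ∞ω} :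
    ContDiffAt ℝ n (fun t => Real.arctan (q / p * cn q t)) t :=
  (Real.contDiff_arctan.comp (contDiff_const.mul (contDiff_cn hq))).contDiffAt

theorem contDiffAt_artanh_sn (hq : q ^ 2 < 1) (t : ℝ) {n : ℕ∞ω} :
    ContDiffAt ℝ n (fun t => Real.artanh (q * sn q t)) t :=
  ContDiffAt.comp (g := Real.artanh) t (Real.analyticAt_artanh (mul_sn_mem_Ioo hq t)).contDiffAt
    (contDiff_const.mul (contDiff_sn hq)).contDiffAt

theorem hasDerivAt_arctan_cn (hp : 0 < p) (hpq : p ^ 2 + q ^ 2 = 1) (hq : q ^ 2 < 1) (t : ℝ) :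
    HasDerivAt (fun t => Real.arctan (q / p * cn q t)) (-p * q * (sn q t / dn q t)) t := by
  refine ((hasDerivAt_cn hq t).const_mul (q / p)).arctan.congr_deriv ?_
  have hd := dn_pos hq t
  have h : 1 + (q / p * cn q t) ^ 2 = dn q t ^ 2 / p ^ 2 := by
    rw [dn_sq hq, mul_pow, cn_sq]
    field_simp
    linear_combination hpq
  rw [h]
  field_simp

theorem hasDerivAt_artanh_sn (hq : q ^ 2 < 1) (t : ℝ) :
    HasDerivAt (fun t => Real.artanh (q * sn q t)) (q * (cn q t / dn q t)) t := by
  refine ((Real.hasDerivAt_artanh (mul_sn_mem_Ioo hq t)).comp t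
    ((hasDerivAt_sn hq t).const_mul q)).congr_deriv ?_
  have hd := dn_pos hq t
  rw [mul_pow, ← dn_sq hq]
  field_simp

/-- By $p^2+q^2=1$ one has $p^2\mathrm{sn}^2+\mathrm{cn}^2=\mathrm{dn}^2$, so the denominator from
arctan collapses to a power of dn. -/
theorem hasDerivAt_arctan_cn_div_sn (hp : 0 < p) (hpq : p ^ 2 + q ^ 2 = 1) (hq : q ^ 2 < 1)
    {t : ℝ} (ht : sn q t ≠ 0) :
    HasDerivAt (fun t => Real.arctan (cn q t / (p * sn q t))) (-p / dn q t) t := by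
  refine ((hasDerivAt_cn hq t).div ((hasDerivAt_sn hq t).const_mul p)
    (mul_ne_zero hp.ne' ht)).arctan.congr_deriv ?_
  have hd := dn_pos hq t
  have c1 := cn_sq q t
  have h : 1 + (cn q t / (p * sn q t)) ^ 2 = dn q t ^ 2 / (p * sn q t) ^ 2 := by
    rw [dn_sq hq, div_pow, cn_sq]
    field_simp
    linear_combination sn q t ^ 2 * hpq
  simp only [Pi.div_apply]
  rw [h]
  field_simp
  linear_combination -c1

theorem dualWith_apply (a b c p q : ℝ) (T : LorentzNumber → LorentzNumber) (w : ℝ × ℝ) :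
    dualWith a b c p q T w = !₂[-(2 * a / p) * (T ⟨w.1, w.2⟩).re,
      2 * b / (p * q) * ((Real.arctan (q / p * cn q (w.1 + w.2)) -
        Real.arctan (q / p * cn q (w.1 - w.2))) / 2),
      2 * c / q * ((Real.artanh (q * sn q (w.1 + w.2)) +
        Real.artanh (q * sn q (w.1 - w.2))) / 2)] := by
  simp only [dualWith, smul_extend, extend_comp]
  ext i
  fin_cases i
  · simp
  · simp [j, extend_im]; ring
  · simp [extend_re]; ring

/-- The ratio of the lengths of corresponding tangent vectors of the dual surface and of the
hyperboloid. -/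
noncomputable def dualRatio (q : ℝ) (w : ℝ × ℝ) : ℝ :=
  2 * sn q w.1 ^ 2 * dn q w.2 ^ 2 / ((1 - q ^ 2 * sn q w.1 ^ 2 * sn q w.2 ^ 2) *
    dn q (w.1 + w.2) * dn q (w.1 - w.2))

theorem dualRatio_pos (hq : q ^ 2 < 1) {w : ℝ × ℝ} (hw : w ∈ domain q) : 0 < dualRatio q w := by
  have hS : sn q w.1 ≠ 0 := hw
  have h1 := dn_pos hq w.2
  have h2 := dn_pos hq (w.1 + w.2)
  have h3 := dn_pos hq (w.1 - w.2)
  have h4 := one_sub_sq_mul_sn_sq_mul_sn_sq_pos hq w.1 w.2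
  unfold dualRatio
  positivity

theorem differentiableAt_dualRatio (hq : q ^ 2 < 1) (w : ℝ × ℝ) :
    DifferentiableAt ℝ (dualRatio q) w := by
  have hs : Differentiable ℝ (sn q) := (contDiff_sn hq (n := 1)).differentiable (by norm_num)
  have hd : Differentiable ℝ (dn q) := (contDiff_dn hq (n := 1)).differentiable (by norm_num)
  have h2 := dn_pos hq (w.1 + w.2)
  have h3 := dn_pos hq (w.1 - w.2)
  have h4 := one_sub_sq_mul_sn_sq_mul_sn_sq_pos hq w.1 w.2
  unfold dualRatio
  have h5 : (1 - q ^ 2 * sn q w.1 ^ 2 * sn q w.2 ^ 2) * dn q (w.1 + w.2) * dn q (w.1 - w.2) ≠ 0 := by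
    positivity
  fun_prop (disch := exact h5)

/-- The right-hand side is the $u$-derivative of the dual in null coordinates. Over the common
denominator $\mathrm{dn}(u+v)\,\mathrm{dn}(u-v)$, the addition theorems make its numerators factor
into functions of $u$ and of $v$, e.g.
$\Delta(\mathrm{dn}(u+v)+\mathrm{dn}(u-v))=2\,\mathrm{dn}\,u\,\mathrm{dn}\,v$. -/
theorem dualRatio_smul_partialU (hq : q ^ 2 < 1) {w : ℝ × ℝ}
    (hw : w ∈ domain q) :
    -dualRatio q w • partialU (param a b c q) w =
      !₂[a * (1 / dn q (w.1 + w.2) + 1 / dn q (w.1 - w.2)),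
        -b * (sn q (w.1 + w.2) / dn q (w.1 + w.2) - sn q (w.1 - w.2) / dn q (w.1 - w.2)),
        c * (cn q (w.1 + w.2) / dn q (w.1 + w.2) + cn q (w.1 - w.2) / dn q (w.1 - w.2))] := by
  have hS : sn q w.1 ≠ 0 := hw
  have hd := (dn_pos hq w.2).ne'
  have hp := (dn_pos hq (w.1 + w.2)).ne'
  have hm := (dn_pos hq (w.1 - w.2)).ne'
  have hΔ := (one_sub_sq_mul_sn_sq_mul_sn_sq_pos hq w.1 w.2).ne'
  have c1 := cn_sq q w.1
  have c2 := cn_sq q w.2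
  have d1 := dn_sq hq w.1
  have d2 := dn_sq hq w.2
  have sp := sn_add hq w.1 w.2
  have cp := cn_add hq w.1 w.2
  have dp := dn_add hq w.1 w.2
  have sm := sn_add hq w.1 (-w.2)
  have cm := cn_add hq w.1 (-w.2)
  have dm := dn_add hq w.1 (-w.2)
  simp only [← sub_eq_add_neg, sn_neg hq, cn_neg hq, dn_neg hq, neg_sq] at sm cm dm
  rw [partialU_param hq hw, dualRatio, sp, cp, sm, cm]
  generalize dn q (w.1 + w.2) = P at *
  generalize dn q (w.1 - w.2) = M at *
  -- `Δ` stays an atom, so that denominators clear cleanly; its definition enters only through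
  -- `linear_combination`.
  obtain ⟨Δ, hΔdef⟩ : ∃ Δ, Δ = 1 - q ^ 2 * sn q w.1 ^ 2 * sn q w.2 ^ 2 := ⟨_, rfl⟩
  rw [← hΔdef] at hΔ dp dm ⊢
  rw [eq_div_iff hΔ] at dp dm
  generalize sn q w.1 = S at *
  generalize cn q w.1 = C at *
  generalize dn q w.1 = D at *
  generalize sn q w.2 = s at *
  generalize cn q w.2 = k at *
  generalize dn q w.2 = d at *
  ext i
  fin_cases i
  · simp
    field_simp
    linear_combination -a * (dp + dm)
  · simp
    field_simp
    apply mul_left_cancel₀ hΔ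
    linear_combination 2 * d * s * b * C * (hΔdef - d1 - q ^ 2 * S ^ 2 * c2) -
      b * (dm * (S * k * d + s * C * D) - dp * (S * k * d - s * C * D))
  · simp
    field_simp
    apply mul_left_cancel₀ hΔ
    linear_combination 2 * d * c * k * C * D * hΔdef -
      c * (dm * (k * C - S * s * d * D) + dp * (k * C + S * s * d * D))

theorem dualRatio_smul_partialV (hq : q ^ 2 < 1) {w : ℝ × ℝ}
    (hw : w ∈ domain q) :
    dualRatio q w • partialV (param a b c q) w =
      !₂[a * (1 / dn q (w.1 + w.2) - 1 / dn q (w.1 - w.2)),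
        -b * (sn q (w.1 + w.2) / dn q (w.1 + w.2) + sn q (w.1 - w.2) / dn q (w.1 - w.2)),
        c * (cn q (w.1 + w.2) / dn q (w.1 + w.2) - cn q (w.1 - w.2) / dn q (w.1 - w.2))] := by
  have hS : sn q w.1 ≠ 0 := hw
  have hd := (dn_pos hq w.2).ne'
  have hp := (dn_pos hq (w.1 + w.2)).ne'
  have hm := (dn_pos hq (w.1 - w.2)).ne'
  have hΔ := (one_sub_sq_mul_sn_sq_mul_sn_sq_pos hq w.1 w.2).ne'
  have c1 := cn_sq q w.1
  have c2 := cn_sq q w.2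
  have d1 := dn_sq hq w.1
  have d2 := dn_sq hq w.2
  have sp := sn_add hq w.1 w.2
  have cp := cn_add hq w.1 w.2
  have dp := dn_add hq w.1 w.2
  have sm := sn_add hq w.1 (-w.2)
  have cm := cn_add hq w.1 (-w.2)
  have dm := dn_add hq w.1 (-w.2)
  simp only [← sub_eq_add_neg, sn_neg hq, cn_neg hq, dn_neg hq, neg_sq] at sm cm dm
  rw [partialV_param hq hw, dualRatio, sp, cp, sm, cm]
  generalize dn q (w.1 + w.2) = P at *
  generalize dn q (w.1 - w.2) = M at *
  obtain ⟨Δ, hΔdef⟩ : ∃ Δ, Δ = 1 - q ^ 2 * sn q w.1 ^ 2 * sn q w.2 ^ 2 := ⟨_, rfl⟩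
  rw [← hΔdef] at hΔ dp dm ⊢
  rw [eq_div_iff hΔ] at dp dm
  generalize sn q w.1 = S at *
  generalize cn q w.1 = C at *
  generalize dn q w.1 = D at *
  generalize sn q w.2 = s at *
  generalize cn q w.2 = k at *
  generalize dn q w.2 = d at *
  ext i
  fin_cases i
  · simp
    field_simp
    linear_combination -a * (dm - dp)
  · simp
    field_simp
    apply mul_left_cancel₀ hΔ
    linear_combination -2 * S * D * k * b * (hΔdef - d2 - q ^ 2 * s ^ 2 * c1) +
      b * (dm * (S * k * d + s * C * D) + dp * (S * k * d - s * C * D))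
  · simp
    field_simp
    apply mul_left_cancel₀ hΔ
    linear_combination -2 * S * s * c * ((1 - q ^ 2) * hΔdef - d1 * d ^ 2 -
      (1 - q ^ 2 * S ^ 2) * d2 + q ^ 2 * (c1 * k ^ 2 + (1 - S ^ 2) * c2)) -
      c * (dm * (k * C - S * s * d * D) - dp * (k * C + S * s * d * D))

/-- Stated for any `θ` with derivative `-p / dn` at the points `u ± v`, and for `y` agreeing with
the dual only on `U`, so that it serves both the principal value and the global branch. -/
theorem isCurvatureLineParam_and_isChristoffelDual (ha : 0 < a) (hb : 0 < b) (hc : 0 < c)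
    (hp : 0 < p) (hq0 : 0 < q) (hpq : p ^ 2 + q ^ 2 = 1) (hq : q ^ 2 < 1)
    (habc : q ^ 2 * (a ^ 2 + c ^ 2) = c ^ 2 - b ^ 2) {U : Set (ℝ × ℝ)} (hU : IsOpen U)
    (hUd : U ⊆ domain q) {θ : ℝ → ℝ} {y : ℝ × ℝ → E3}
    (hy : EqOn y (dualWith a b c p q (extend θ)) U)
    (hθp : ∀ w ∈ U, ContDiffAt ℝ ∞ θ (w.1 + w.2) ∧ HasDerivAt θ (-p / dn q (w.1 + w.2)) (w.1 + w.2))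
    (hθm : ∀ w ∈ U, ContDiffAt ℝ ∞ θ (w.1 - w.2) ∧
      HasDerivAt θ (-p / dn q (w.1 - w.2)) (w.1 - w.2)) :
    IsCurvatureLineParam U y ∧ IsChristoffelDual U (param a b c q) y := by
  have hsmooth : ContDiffOn ℝ ∞ (dualWith a b c p q (extend θ)) U := by
    simp only [show dualWith a b c p q (extend θ) = _ from
      funext (dualWith_apply a b c p q (extend θ)), extend_re]
    have hadd (w : ℝ × ℝ) : ContDiffAt ℝ ∞ (fun w : ℝ × ℝ => w.1 + w.2) w := by fun_prop
    have hsub (w : ℝ × ℝ) : ContDiffAt ℝ ∞ (fun w : ℝ × ℝ => w.1 - w.2) w := by fun_prop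
    refine ContDiffOn.vec3 (fun w hw => ContDiffAt.contDiffWithinAt ?_)
      (fun w _ => ContDiffAt.contDiffWithinAt ?_) (fun w _ => ContDiffAt.contDiffWithinAt ?_)
    · exact contDiffAt_const.mul ((((hθp w hw).1.comp w (hadd w)).add
        ((hθm w hw).1.comp w (hsub w))).div_const 2)
    · exact contDiffAt_const.mul ((((contDiffAt_arctan_cn hq _).comp w (hadd w)).sub
        ((contDiffAt_arctan_cn hq _).comp w (hsub w))).div_const 2)
    · exact contDiffAt_const.mul ((((contDiffAt_artanh_sn hq _).comp w (hadd w)).add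
        ((contDiffAt_artanh_sn hq _).comp w (hsub w))).div_const 2)
  have hdiff (w) (hw : w ∈ U) : DifferentiableAt ℝ (dualWith a b c p q (extend θ)) w :=
    (hsmooth.contDiffAt (hU.mem_nhds hw)).differentiableAt (by simp)
  have hfderiv (w) (hw : w ∈ U) : fderiv ℝ y w = fderiv ℝ (dualWith a b c p q (extend θ)) w :=
    (hy.eventuallyEq_of_mem (hU.mem_nhds hw)).fderiv_eq
  refine isCurvatureLineParam_and_isChristoffelDual_of_smul (r := dualRatio q)
    ((isCurvatureLineParam_param ha hb hc hq habc).mono hU hUd) (hsmooth.congr hy)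
    (fun w hw => dualRatio_pos hq (hUd hw)) (fun w _ => differentiableAt_dualRatio hq w)
    (fun w hw => ?_) (fun w hw => ?_)
  · rw [partialU, hfderiv w hw, dualRatio_smul_partialU hq (hUd hw)]
    refine partialU_eq_of_hasDerivAt (hdiff w hw) ?_
    simp only [dualWith_apply, extend_re]
    refine HasDerivAt.vec3
      (HasDerivAt.congr_deriv ((((hθp w hw).2.comp_add_const w.1 w.2).add
        ((hθm w hw).2.comp_sub_const w.1 w.2)).div_const 2 |>.const_mul (-(2 * a / p))) ?_)
      (HasDerivAt.congr_deriv ((((hasDerivAt_arctan_cn hp hpq hq _).comp_add_const w.1 w.2).sub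
        ((hasDerivAt_arctan_cn hp hpq hq _).comp_sub_const w.1 w.2)).div_const 2
          |>.const_mul (2 * b / (p * q))) ?_)
      (HasDerivAt.congr_deriv ((((hasDerivAt_artanh_sn hq _).comp_add_const w.1 w.2).add
        ((hasDerivAt_artanh_sn hq _).comp_sub_const w.1 w.2)).div_const 2
          |>.const_mul (2 * c / q)) ?_) <;>
    · field_simp
      try ring
  · rw [partialV, hfderiv w hw, dualRatio_smul_partialV hq (hUd hw)]
    refine partialV_eq_of_hasDerivAt (hdiff w hw) ?_
    simp only [dualWith_apply, extend_re]
    refine HasDerivAt.vec3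
      (HasDerivAt.congr_deriv ((((hθp w hw).2.comp_const_add w.1 w.2).add
        ((hθm w hw).2.comp_const_sub w.1 w.2)).div_const 2 |>.const_mul (-(2 * a / p))) ?_)
      (HasDerivAt.congr_deriv ((((hasDerivAt_arctan_cn hp hpq hq _).comp_const_add w.1 w.2).sub
        ((hasDerivAt_arctan_cn hp hpq hq _).comp_const_sub w.1 w.2)).div_const 2
          |>.const_mul (2 * b / (p * q))) ?_)
      (HasDerivAt.congr_deriv ((((hasDerivAt_artanh_sn hq _).comp_const_add w.1 w.2).add
        ((hasDerivAt_artanh_sn hq _).comp_const_sub w.1 w.2)).div_const 2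
          |>.const_mul (2 * c / q)) ?_) <;>
    · field_simp
      try ring

theorem isOpen_dualDomain (hq : q ^ 2 < 1) : IsOpen (dualDomain q) := by
  have h : Continuous (sn q) := (contDiff_sn hq (n := 0)).continuous
  have : dualDomain q = domain q ∩
      ({w | sn q (w.1 + w.2) ≠ 0} ∩ {w | sn q (w.1 - w.2) ≠ 0}) := by
    ext w
    change _ ∧ _ ↔ _ ∧ _ ∧ _
    rw [isUnit_iff, extend_re_add_im, extend_re_sub_im]
    rfl
  rw [this]
  exact (isOpen_domain hq).inter
    ((isOpen_ne_fun (by fun_prop) continuous_const).inter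
      (isOpen_ne_fun (by fun_prop) continuous_const))

theorem dual_eqOn (hp : p ≠ 0) : EqOn (dual a b c p q)
    (dualWith a b c p q (extend fun t => Real.arctan (cn q t / (p * sn q t))))
    (dualDomain q) := by
  intro w hw
  have hunit : IsUnit (extend (fun t => p * sn q t) ⟨w.1, w.2⟩) := by
    have := hw.2
    rw [isUnit_iff, extend_re_add_im, extend_re_sub_im] at this ⊢
    exact ⟨mul_ne_zero hp this.1, mul_ne_zero hp this.2⟩
  rw [dual, dualWith_apply, dualWith_apply, smul_extend, extend_div_extend _ _ hunit,
    extend_comp]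

end Hyperboloid

/-! ### Assembly. -/

theorem mainTheorem7 (a b c p q : ℝ) (ha : 0 < a) (hb : 0 < b) (hc : 0 < c) (hbc : b < c)
    (hp : p = √((a ^ 2 + b ^ 2) / (a ^ 2 + c ^ 2)))
    (hq : q = √(-((b ^ 2 - c ^ 2) / (a ^ 2 + c ^ 2)))) :
    -- the functions used are the Lorentz-analytic extensions of the real functions
    (LorentzNumber.IsAnalyticExtension (Jacobi.sn q) Set.univ
        (LorentzNumber.extend (Jacobi.sn q)) ∧
      LorentzNumber.IsAnalyticExtension (Jacobi.cn q) Set.univ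
        (LorentzNumber.extend (Jacobi.cn q)) ∧
      LorentzNumber.IsAnalyticExtension Real.arctan Set.univ
        (LorentzNumber.extend Real.arctan) ∧
      LorentzNumber.IsAnalyticExtension Real.artanh (Set.Ioo (-1) 1)
        (LorentzNumber.extend Real.artanh)) ∧
    -- the whole hyperboloid is parametrized by curvature lines
    (IsCurvatureLineParam (Hyperboloid.domain q) (Hyperboloid.param a b c q) ∧
      Hyperboloid.param a b c q '' Hyperboloid.domain q = Hyperboloid.surface a b c) ∧
    -- the dual, with principal values of the arctangent
    (IsCurvatureLineParam (Hyperboloid.dualDomain q) (Hyperboloid.dual a b c p q) ∧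
      IsChristoffelDual (Hyperboloid.dualDomain q)
        (Hyperboloid.param a b c q) (Hyperboloid.dual a b c p q)) ∧
    -- the dual of the whole hyperboloid, with a continuous branch `θ` of `arctan (cn / (p sn))`
    ∃ θ : ℝ → ℝ, AnalyticOnNhd ℝ θ Set.univ ∧
      (∀ t, p * Jacobi.sn q t * Real.sin (θ t) = Jacobi.cn q t * Real.cos (θ t)) ∧
      LorentzNumber.IsAnalyticExtension θ Set.univ (LorentzNumber.extend θ) ∧
      IsCurvatureLineParam (Hyperboloid.domain q)
        (Hyperboloid.dualWith a b c p q (LorentzNumber.extend θ)) ∧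
      IsChristoffelDual (Hyperboloid.domain q) (Hyperboloid.param a b c q)
        (Hyperboloid.dualWith a b c p q (LorentzNumber.extend θ)) := by
  have hac : 0 < a ^ 2 + c ^ 2 := by positivity
  have hbc2 : 0 < c ^ 2 - b ^ 2 := sub_pos.2 (pow_lt_pow_left₀ hbc hb.le two_ne_zero)
  have hp0 : 0 < p := hp ▸ Real.sqrt_pos.2 (by positivity)
  have hqarg : 0 < -((b ^ 2 - c ^ 2) / (a ^ 2 + c ^ 2)) := by
    rw [← neg_div, neg_sub]
    positivity
  have hq0 : 0 < q := hq ▸ Real.sqrt_pos.2 hqarg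
  have hp2 : p ^ 2 = (a ^ 2 + b ^ 2) / (a ^ 2 + c ^ 2) := by
    rw [hp, Real.sq_sqrt (by positivity)]
  have hq2 : q ^ 2 = -((b ^ 2 - c ^ 2) / (a ^ 2 + c ^ 2)) := by
    rw [hq, Real.sq_sqrt hqarg.le]
  have habc : q ^ 2 * (a ^ 2 + c ^ 2) = c ^ 2 - b ^ 2 := by
    rw [hq2]; field_simp; ring
  have hpq : p ^ 2 + q ^ 2 = 1 := by
    rw [hp2, hq2]; field_simp; ring
  have hq1 : q ^ 2 < 1 := by linarith [pow_pos hp0 2]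
  have hpsqrt : √(1 - q ^ 2) = p := by
    rw [show 1 - q ^ 2 = p ^ 2 by linarith, Real.sqrt_sq hp0.le]
  refine ⟨⟨LorentzNumber.isAnalyticExtension_extend fun t _ => Jacobi.analyticAt_sn hq1 t,
    LorentzNumber.isAnalyticExtension_extend fun t _ => Jacobi.analyticAt_cn hq1 t,
    LorentzNumber.isAnalyticExtension_extend fun t _ => Real.analyticAt_arctan t,
    LorentzNumber.isAnalyticExtension_extend fun t ht => Real.analyticAt_artanh ht⟩,
    ⟨Hyperboloid.isCurvatureLineParam_param ha hb hc hq1 habc,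
      Hyperboloid.image_param ha hb hc hq1⟩, ?_, ?_⟩
  · have hder {t : ℝ} (ht : Jacobi.sn q t ≠ 0) :
        ContDiffAt ℝ ∞ (fun t => Real.arctan (Jacobi.cn q t / (p * Jacobi.sn q t))) t ∧
        HasDerivAt (fun t => Real.arctan (Jacobi.cn q t / (p * Jacobi.sn q t)))
          (-p / Jacobi.dn q t) t :=
      ⟨((Jacobi.contDiff_cn hq1).contDiffAt.div
        (contDiff_const.mul (Jacobi.contDiff_sn hq1)).contDiffAt (mul_ne_zero hp0.ne' ht)).arctan,
        Hyperboloid.hasDerivAt_arctan_cn_div_sn hp0 hpq hq1 ht⟩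
    have hunit (w) (hw : w ∈ Hyperboloid.dualDomain q) :
        Jacobi.sn q (w.1 + w.2) ≠ 0 ∧ Jacobi.sn q (w.1 - w.2) ≠ 0 := by
      have := hw.2
      rwa [LorentzNumber.isUnit_iff, LorentzNumber.extend_re_add_im,
        LorentzNumber.extend_re_sub_im] at this
    exact Hyperboloid.isCurvatureLineParam_and_isChristoffelDual ha hb hc hp0 hq0 hpq hq1 habc
      (Hyperboloid.isOpen_dualDomain hq1) (fun w hw => hw.1) (Hyperboloid.dual_eqOn hp0.ne')
      (fun w hw => hder (hunit w hw).1) (fun w hw => hder (hunit w hw).2)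
  -- The shift by $K$ gives $\sin\theta=-\mathrm{cn}/\mathrm{dn}$,
  -- $\cos\theta=-p\,\mathrm{sn}/\mathrm{dn}$ and $\theta'=-p/\mathrm{dn}$, so
  -- $\tan\theta=\mathrm{cn}/(p\,\mathrm{sn})$ wherever $\mathrm{sn}\ne0$, while `θ` is analytic
  -- also across the zeros of sn.
  · set θ : ℝ → ℝ := fun t => -Jacobi.am q (t + Jacobi.ellipticK q) with hθ
    have hθan (t : ℝ) : AnalyticAt ℝ θ t :=
      (AnalyticAt.comp (g := Jacobi.am q) (f := fun t => t + Jacobi.ellipticK q)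
        (Jacobi.analyticAt_am hq1 _) (analyticAt_id.add analyticAt_const)).neg
    have hder (t : ℝ) : ContDiffAt ℝ ∞ θ t ∧ HasDerivAt θ (-p / Jacobi.dn q t) t := by
      refine ⟨(hθan t).contDiffAt,
        ((Jacobi.hasDerivAt_am hq1 _).comp_add_const t _).neg.congr_deriv ?_⟩
      rw [Jacobi.dn_add_ellipticK hq1, hpsqrt, neg_div]
    refine ⟨θ, fun t _ => hθan t, fun t => ?_,
      LorentzNumber.isAnalyticExtension_extend fun t _ => hθan t,
      Hyperboloid.isCurvatureLineParam_and_isChristoffelDual ha hb hc hp0 hq0 hpq hq1 habc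
        (Hyperboloid.isOpen_domain hq1) Subset.rfl (fun w _ => rfl)
        (fun w _ => hder _) (fun w _ => hder _)⟩
    have h1 := Jacobi.sn_add_ellipticK hq1 t
    have h2 := Jacobi.cn_add_ellipticK hq1 t
    rw [hpsqrt] at h2
    simp only [hθ, Real.sin_neg, Real.cos_neg]
    rw [Jacobi.sn] at h1
    rw [Jacobi.cn] at h2
    rw [h1, h2]
    ring
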